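/- **Setting.** Let $G$ be a compact, second countable Hausdorff topological group (for instance any compact Lie group, finite groups included) with Haar measure of total mass one. A lattice is a finite directed graph with vertex set $\mathcal V$, edge set $\mathcal E$ and a set $\mathcal B\subset\mathcal V$ of global boundary vertices. The kinematical Hilbert space is $\mathcal H_{\rm kin}=\bigotimes_{e\in\mathcal E}L^2(G)=L^2(G^{\mathcal E})$, with $U_e(a)V_e(b)|g\rangle_e=|agb^{-1}\rangle_e$. A gauge transformation by $h\in G$ at a vertex $v\notin\mathcal B$ acts by $U_e(h)$ on every edge $e$ ending at $v$ and by $V_e(h)$ on every edge starting at $v$. A region $\Sigma$ consists of disjoint sets of corner vertices and interior vertices, none of them in $\mathcal B$, and disjoint sets of corner edges and interior edges, such that corner edges join corner vertices, interior edges join vertices of $\Sigma$, and every edge incident to an interior vertex is an interior edge. Write $\partial\Sigma$ for the corner and $\mathring\Sigma$ for the interior. The corner gauge group $\mathcal G_{\partial\Sigma}=G^{V_{\partial\Sigma}}$ acts by $U(\mathbf g)$ through the gauge transformations at the corner vertices, and $\Pi^{\rm phys}_{\partial\Sigma}=\int_{\mathcal G_{\partial\Sigma}}U(\mathbf g)\,d\mathbf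 g$ is its coherent group average. An intrinsic frame $\tilde\Phi$ is a rooted spanning tree of the corner. An extrinsic frame $\Phi$ consists of one Wilson line for every corner vertex $v$, running from a vertex of $\mathcal B$ to $v$ along edges that are neither corner nor interior edges, no edge being used twice within $\Phi$. Its orientation states $|\mathbf g\rangle_\Phi$, $\mathbf g\in G^{V_{\partial\Sigma}}$, are the generalised eigenstates of the holonomies of these lines, and satisfy $U(\mathbf h)|\mathbf g\rangle_\Phi=|\mathbf h\mathbf g\rangle_\Phi$. Its reorientation group $\mathbb G_{\partial\Sigma}\simeq G^{V_{\partial\Sigma}}$ acts by unitaries $V_\Phi(\mathbf h)$, $|\mathbf g\rangle_\Phi\mapsto|\mathbf g\mathbf h^{-1}\rangle_\Phi$, namely by the group translation, on the side of the anchor vertex, of the first edge of every Wilson line. Two extrinsic frames are non-overlapping if their Wilson lines have no edge in common. Let $S_\alpha$ be one of $\mathring\Sigma$, $\partial\Sigma\setminus\tilde\Phi$, $\tilde\Phi$ (that is, the interior edges, the corner edges outside the tree, the edges of the tree), or any of their unions. Let $\mathcal H^{\rm phys}_{S_\alpha}$ be the space of wave functions of the edges of $S_\alpha$ that are invariant under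 the gauge transformations at all vertices outside $\mathcal B\cup\partial\Sigma$, and let $\mathcal A_{S_\alpha}=\mathcal B(\mathcal H^{\rm phys}_{S_\alpha})$, acting as $f\otimes 1$ on the subspace $\mathcal H^{\partial\Sigma}_{\rm kin}\subset\mathcal H_{\rm kin}$ of all states invariant under those gauge transformations. Let $\mathcal A^{\mathcal G_{\partial\Sigma}}_{S_\alpha}$ be the subalgebra of those elements of $\mathcal A_{S_\alpha}$ that commute with all $U(\mathbf g)$, $\mathbf g\in\mathcal G_{\partial\Sigma}$. The relational observable of $f\in\mathcal A_{S_\alpha}$ relative to $\Phi$ in orientation $\mathbf g$ is $$O_{f|\Phi}(\mathbf g)=\int_{\mathcal G_{\partial\Sigma}}d\mathbf h\;U(\mathbf h)\big(|\mathbf g\rangle\langle\mathbf g|_\Phi\otimes f\big)U(\mathbf h)^\dagger=\int d\mathbf h\;|\mathbf h\rangle\langle\mathbf h|_\Phi\otimes U(\mathbf h\mathbf g^{-1})fU(\mathbf h\mathbf g^{-1})^\dagger ,$$ where, in the last expression, $U$ is the action of $\mathcal G_{\partial\Sigma}$ on the edges of $\Sigma$. The relational algebra of $S_\alpha$ relative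 to $\Phi$ is $$\mathcal A^{\rm phys}_{S_\alpha|\Phi}=\{O_{f|\Phi}(\mathbf g)\,\Pi^{\rm phys}_{\partial\Sigma}:f\in\mathcal A_{S_\alpha}\}$$ (which does not depend on the choice of $\mathbf g$). **Proposition 1 (Extrinsic relational algebra intersections).** Let $\Phi,\Phi'$ be two non-overlapping extrinsic frames for $\partial\Sigma$, let $\tilde\Phi$ be an intrinsic frame, and let $S_\alpha$ be any of the regional subsystems $\mathring\Sigma$, $\partial\Sigma\setminus\tilde\Phi$, $\tilde\Phi$ or any of their unions. Then, for any choice of the orientations in the definition of the two relational algebras, $$\mathcal A^{\rm phys}_{S_\alpha|\Phi}\cap\mathcal A^{\rm phys}_{S_\alpha|\Phi'}=\Pi^{\rm phys}_{\partial\Sigma}\,\mathcal A_{S_\alpha}\,\Pi^{\rm phys}_{\partial\Sigma}=\mathcal A^{\mathcal G_{\partial\Sigma}}_{S_\alpha}\,\Pi^{\rm phys}_{\partial\Sigma}=\mathbb G_{\partial\Sigma}\big(\mathcal A^{\rm phys}_{S_\alpha|\Phi}\big)=\mathbb G'_{\partial\Sigma}\big(\mathcal A^{\rm phys}_{S_\alpha|\Phi'}\big),$$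 where $\mathbb G_{\partial\Sigma}(X)=\int d\mathbf h\,V_\Phi(\mathbf h)XV_\Phi(\mathbf h)^\dagger$ and $\mathbb G'_{\partial\Sigma}(X)=\int d\mathbf h\,V_{\Phi'}(\mathbf h)XV_{\Phi'}(\mathbf h)^\dagger$ are the incoherent twirls over the reorientation groups of $\Phi$ and $\Phi'$. -/

import Mathlib

set_option linter.unusedSectionVars false

open MeasureTheory

noncomputable section

namespace LatticeGauge

universe u v w

/-! ### Haar measure, wave functions on link configurations, and averages -/

section Hilbert

variable (G : Type u) [Group G] [TopologicalSpace G] [IsTopologicalGroup G] [CompactSpace G]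
  [T2Space G] [SecondCountableTopology G] [MeasurableSpace G] [BorelSpace G]

/-- The Haar measure of the compact group `G`, of total mass one. -/
def haarProb : Measure G := Measure.haarMeasure ⊤

instance : IsProbabilityMeasure (haarProb G) :=
  ⟨by simpa [haarProb] using Measure.haarMeasure_self (K₀ := (⊤ : TopologicalSpace.PositiveCompacts G))⟩

instance : (haarProb G).IsHaarMeasure := by unfold haarProb; infer_instance

instance : (haarProb G).IsMulRightInvariant :=
  ⟨fun g => by
    have h : IsProbabilityMeasure ((haarProb G).map (· * g)) :=
      Measure.isProbabilityMeasure_map (measurable_mul_const g).aemeasurable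
    exact Measure.isHaarMeasure_eq_of_isProbabilityMeasure _ _⟩

/-- The normalised Haar measure on `G ^ ι`. -/
abbrev haarPi (ι : Type v) [Fintype ι] : Measure (ι → G) := Measure.pi fun _ => haarProb G

/-- `⨂_{e ∈ ι} L²(G) = L²(G ^ ι)`, the wave functions of the links labelled by `ι`. -/
abbrev LinkSpace (ι : Type v) [Fintype ι] : Type (max u v) := Lp ℂ 2 (haarPi G ι)

variable {G}

/-- `x_e ↦ a_e x_e b_e⁻¹` on configurations of the links labelled by `ι`. -/
def linkTranslate {ι : Type v} (a b : ι → G) (x : ι → G) : ι → G := fun e => a e * x e * (b e)⁻¹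

theorem measurePreserving_linkTranslate {ι : Type v} [Fintype ι] (a b : ι → G) :
    MeasurePreserving (linkTranslate a b) (haarPi G ι) (haarPi G ι) :=
  measurePreserving_pi (fun _ => haarProb G) (fun _ => haarProb G) fun e =>
    (measurePreserving_mul_right (haarProb G) ((b e)⁻¹)).comp
      (measurePreserving_mul_left (haarProb G) (a e))

/-- The unitary `⨂_e U_e(a_e) V_e(b_e)`, where `U_e(a) V_e(b) |g⟩_e = |a g b⁻¹⟩_e`. On wave functions
it is `ψ ↦ (x ↦ ψ (a⁻¹ x b))`. -/
def linkUnitary {ι : Type v} [Fintype ι] (a b : ι → G) : LinkSpace G ι →L[ℂ] LinkSpace G ι :=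
  (Lp.compMeasurePreservingₗᵢ ℂ (linkTranslate a⁻¹ b⁻¹)
    (measurePreserving_linkTranslate a⁻¹ b⁻¹)).toContinuousLinearMap

/-- If the link variables indexed by `D` are translated by group elements that depend measurably on
the other link variables only, Haar measure is preserved. -/
theorem measurePreserving_controlled {ι : Type v} [Fintype ι] [DecidableEq ι] (D : Finset ι)
    (a b : (ι → G) → ι → G) (ha : Measurable a) (hb : Measurable b)
    (ha1 : ∀ x, ∀ e ∉ D, a x e = 1) (hb1 : ∀ x, ∀ e ∉ D, b x e = 1)
    (had : ∀ x y, (∀ e ∉ D, x e = y e) → a x = a y)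
    (hbd : ∀ x y, (∀ e ∉ D, x e = y e) → b x = b y) :
    MeasurePreserving (fun x => linkTranslate (a x) (b x) x) (haarPi G ι) (haarPi G ι) := by
  have hE := measurePreserving_piEquivPiSubtypeProd (fun _ : ι => haarProb G) (fun e => e ∉ D)
  set E := MeasurableEquiv.piEquivPiSubtypeProd (fun _ : ι => G) (fun e => e ∉ D) with hEdef
  let ext : ({e // e ∉ D} → G) → ι → G := fun y => E.symm (y, 1)
  have hext : Measurable ext := E.symm.measurable.comp (measurable_id.prodMk measurable_const)
  have hagree : ∀ x : ι → G, ∀ e ∉ D, x e = ext (E x).1 e := by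
    intro x e he
    simp [ext, hEdef, MeasurableEquiv.piEquivPiSubtypeProd, Equiv.piEquivPiSubtypeProd, he]
  let a' : ({e // e ∉ D} → G) → {e // ¬ e ∉ D} → G := fun y e => a (ext y) e
  let b' : ({e // e ∉ D} → G) → {e // ¬ e ∉ D} → G := fun y e => b (ext y) e
  have ha' : Measurable a' :=
    measurable_pi_lambda _ fun e => (measurable_pi_apply e.1).comp (ha.comp hext)
  have hb' : Measurable b' :=
    measurable_pi_lambda _ fun e => (measurable_pi_apply e.1).comp (hb.comp hext)
  have hS : MeasurePreserving (fun p : ({e // e ∉ D} → G) × ({e // ¬ e ∉ D} → G) =>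
      (p.1, linkTranslate (a' p.1) (b' p.1) p.2))
      ((haarPi G {e // e ∉ D}).prod (haarPi G {e // ¬ e ∉ D}))
      ((haarPi G {e // e ∉ D}).prod (haarPi G {e // ¬ e ∉ D})) := by
    refine (MeasurePreserving.id _).skew_product (g := fun y => linkTranslate (a' y) (b' y)) ?_ ?_
    · refine measurable_pi_lambda _ fun e => ?_
      have h1 : Measurable fun p : ({e // e ∉ D} → G) × ({e // ¬ e ∉ D} → G) => a' p.1 e :=
        (measurable_pi_apply e).comp (ha'.comp measurable_fst)
      have h2 : Measurable fun p : ({e // e ∉ D} → G) × ({e // ¬ e ∉ D} → G) => b' p.1 e :=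
        (measurable_pi_apply e).comp (hb'.comp measurable_fst)
      have h3 : Measurable fun p : ({e // e ∉ D} → G) × ({e // ¬ e ∉ D} → G) => p.2 e :=
        (measurable_pi_apply e).comp measurable_snd
      exact (h1.mul h3).mul h2.inv
    · exact Filter.Eventually.of_forall fun y => (measurePreserving_linkTranslate (a' y) (b' y)).map_eq
  have := (hE.symm.comp hS).comp hE
  convert! this using 1
  funext x
  apply E.injective
  have h1 : a x = a (ext (E x).1) := had _ _ (hagree x)
  have h2 : b x = b (ext (E x).1) := hbd _ _ (hagree x)
  simp only [Function.comp, MeasurableEquiv.apply_symm_apply]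
  refine Prod.ext ?_ ?_
  · funext e
    simp [hEdef, MeasurableEquiv.piEquivPiSubtypeProd, Equiv.piEquivPiSubtypeProd, linkTranslate,
      ha1 x e.1 e.2, hb1 x e.1 e.2]
  · funext e
    simp only [linkTranslate, a', b', ← h1, ← h2]
    rfl

/-- The strong integral `∫ A(k) dμ(k)` of a family of bounded operators: the operator
`φ ↦ ∫ A(k) φ dμ(k)`. (The condition holds for bounded, strongly continuous families.) -/
def strongAverage {K : Type v} [MeasurableSpace K] (μ : Measure K) [IsFiniteMeasure μ]
    {H : Type w} [NormedAddCommGroup H] [NormedSpace ℂ H] [CompleteSpace H]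
    (A : K → H →L[ℂ] H) : H →L[ℂ] H := by
  classical
  exact
    if h : (∀ φ, Integrable (fun k => A k φ) μ) ∧ ∃ C : ℝ, ∀ k, ‖A k‖ ≤ C then
      LinearMap.mkContinuousOfExistsBound
        { toFun := fun φ => ∫ k, A k φ ∂μ
          map_add' := fun φ ψ => by
            simp only [map_add]; exact integral_add (h.1 φ) (h.1 ψ)
          map_smul' := fun c φ => by
            simp only [map_smul, RingHom.id_apply]; exact integral_smul c _ }
        (by
          obtain ⟨C, hC⟩ := h.2
          refine ⟨C * μ.real Set.univ, fun φ => ?_⟩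
          have := norm_integral_le_of_norm_le_const (μ := μ) (f := fun k => A k φ) (C := C * ‖φ‖)
            (Filter.Eventually.of_forall fun k =>
              ((A k).le_opNorm φ).trans (mul_le_mul_of_nonneg_right (hC k) (norm_nonneg φ)))
          calc ‖∫ k, A k φ ∂μ‖ ≤ C * ‖φ‖ * μ.real Set.univ := this
            _ = C * μ.real Set.univ * ‖φ‖ := by ring)
    else 0

/-- The incoherent average `∫ U(k) X U(k)† dμ(k)` of an operator `X`. -/
def twirl {K : Type v} [MeasurableSpace K] (μ : Measure K) [IsFiniteMeasure μ]
    {H : Type w} [NormedAddCommGroup H] [InnerProductSpace ℂ H] [CompleteSpace H]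
    (U : K → H →L[ℂ] H) (X : H →L[ℂ] H) : H →L[ℂ] H :=
  strongAverage μ fun k => U k ∘L X ∘L ContinuousLinearMap.adjoint (U k)

end Hilbert

/-! ### Lattices, regions and Wilson lines -/

/-- A spatial lattice: a directed graph with edges `E` and vertices `V`, together with the set of
vertices on its global boundary. Edge `e` runs from `src e` to `tgt e`. -/
structure Lattice (V : Type v) (E : Type w) where
  src : E → V
  tgt : E → V
  /-- the vertices on the global boundary -/
  boundary : Finset V

/-- An edge traversed along its orientation (`true`) or against it (`false`). -/
abbrev OrientedEdge (E : Type w) : Type w := E × Bool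

namespace Lattice

variable {V : Type v} {E : Type w} (L : Lattice V E)

/-- The vertices off the global boundary, where small gauge transformations act. -/
def bulk [Fintype V] [DecidableEq V] : Finset V := (L.boundary)ᶜ

/-- Initial vertex of an oriented edge. -/
def start : OrientedEdge E → V
  | (e, true) => L.src e
  | (e, false) => L.tgt e

/-- Final vertex of an oriented edge. -/
def finish : OrientedEdge E → V
  | (e, true) => L.tgt e
  | (e, false) => L.src e

/-- `L.IsWalk u p w`: the oriented edges in the list `p` form a walk from `u` to `w`. -/
def IsWalk : V → List (OrientedEdge E) → V → Prop
  | u, [], w => u = w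
  | u, d :: p, w => L.start d = u ∧ IsWalk (L.finish d) p w

/-- A walk that uses no edge twice. -/
def IsTrail (u : V) (p : List (OrientedEdge E)) (w : V) : Prop :=
  L.IsWalk u p w ∧ (p.map Prod.fst).Nodup

end Lattice

/-- The holonomy `g_n ⋯ g_1` of a configuration along the oriented edges `d_1, …, d_n`, where `g_i` is
the link variable of `d_i`, inverted if the edge is traversed against its orientation. -/
def holonomy {E : Type w} {G : Type u} [Group G] (x : E → G) : List (OrientedEdge E) → G
  | [] => 1
  | (e, true) :: p => holonomy x p * x e
  | (e, false) :: p => holonomy x p * (x e)⁻¹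

/-- A finite region `Σ` of the lattice, away from the global boundary: its corner `∂Σ` (vertices and
edges) and its interior (vertices and edges). All other edges belong to the complement of `Σ`. -/
structure Region {V : Type v} {E : Type w} (L : Lattice V E) where
  cornerV : Finset V
  interiorV : Finset V
  cornerE : Finset E
  interiorE : Finset E
  disjointV : Disjoint cornerV interiorV
  disjointE : Disjoint cornerE interiorE
  corner_bulk : Disjoint cornerV L.boundary
  interior_bulk : Disjoint interiorV L.boundary
  /-- corner edges join corner vertices -/
  cornerE_ends : ∀ e ∈ cornerE, L.src e ∈ cornerV ∧ L.tgt e ∈ cornerV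
  /-- interior edges join vertices of the region -/
  interiorE_ends : ∀ e ∈ interiorE,
    (L.src e ∈ cornerV ∨ L.src e ∈ interiorV) ∧ (L.tgt e ∈ cornerV ∨ L.tgt e ∈ interiorV)
  /-- every edge incident to an interior vertex is an interior edge -/
  interior_incident : ∀ e, L.src e ∈ interiorV ∨ L.tgt e ∈ interiorV → e ∈ interiorE

/-- An intrinsic frame: a spanning tree of the corner, rooted at a corner vertex. That the edge set
`tree` is a spanning tree is expressed by: every corner vertex is reached from the root by exactly
one trail in `tree`. -/
structure IntrinsicFrame {V : Type v} {E : Type w} {L : Lattice V E} (R : Region L) where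
  tree : Finset E
  root : V
  root_mem : root ∈ R.cornerV
  tree_subset : tree ⊆ R.cornerE
  spanning : ∀ v ∈ R.cornerV, ∃! p : List (OrientedEdge E),
    L.IsTrail root p v ∧ ∀ d ∈ p, d.1 ∈ tree

/-- An extrinsic frame: for every corner vertex `v` a Wilson line in the complement of the region from
an anchor on the global boundary to `v`, no edge being used twice. -/
structure ExtrinsicFrame {V : Type v} {E : Type w} {L : Lattice V E} (R : Region L) where
  line : R.cornerV → List (OrientedEdge E)
  anchor : R.cornerV → V
  anchor_mem : ∀ v, anchor v ∈ L.boundary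
  isTrail : ∀ v, L.IsTrail (anchor v) (line v) v
  exterior : ∀ v, ∀ d ∈ line v, d.1 ∉ R.cornerE ∧ d.1 ∉ R.interiorE
  edge_disjoint : ∀ v w, v ≠ w → ∀ d ∈ line v, ∀ d' ∈ line w, d.1 ≠ d'.1

/-- Two extrinsic frames are non-overlapping if their Wilson lines have no edge in common. -/
def NonOverlapping {V : Type v} {E : Type w} {L : Lattice V E} {R : Region L}
    (Φ Φ' : ExtrinsicFrame R) : Prop :=
  ∀ v w, ∀ d ∈ Φ.line v, ∀ d' ∈ Φ'.line w, d.1 ≠ d'.1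

/-- The three elementary regional subsystems. -/
inductive RegionalPart : Type
  /-- the interior of the region -/
  | interior
  /-- the corner edges outside the tree of the intrinsic frame -/
  | cornerRest
  /-- the intrinsic frame itself -/
  | intrinsic

/-- The edges of an elementary regional subsystem. -/
def partEdges {V : Type v} {E : Type w} [DecidableEq E] {L : Lattice V E} {R : Region L}
    (T : IntrinsicFrame R) : RegionalPart → Finset E
  | .interior => R.interiorE
  | .cornerRest => R.cornerE \ T.tree
  | .intrinsic => T.tree

/-- The edges of a union `α` of elementary regional subsystems. -/
def subsystemEdges {V : Type v} {E : Type w} [DecidableEq E] {L : Lattice V E} {R : Region L}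
    (T : IntrinsicFrame R) (α : Finset RegionalPart) : Finset E :=
  α.biUnion (partEdges T)

/-! ### Gauge transformations and the physical projectors -/

section Gauge

variable {G : Type u} [Group G] [TopologicalSpace G] [IsTopologicalGroup G] [CompactSpace G]
  [T2Space G] [SecondCountableTopology G] [MeasurableSpace G] [BorelSpace G]
  {V : Type v} [Fintype V] [DecidableEq V] {E : Type w} [Fintype E] [DecidableEq E]

/-- An element of `G ^ S`, extended by `1` to all vertices. -/
def extendOne (S : Finset V) (g : S → G) : V → G :=
  fun v => if h : v ∈ S then g ⟨v, h⟩ else 1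

/-- The gauge transformation by `g` on the links in `F` with endpoints given by `s` and `t`, that is,
`⨂_e U_e(g_{t(e)}) V_e(g_{s(e)})`: the vertex `v` acts by `U_e(g_v)` on ingoing edges and by
`V_e(g_v)` on outgoing edges. -/
def gaugeUnitary {F : Type w} [Fintype F] (s t : F → V) (g : V → G) :
    LinkSpace G F →L[ℂ] LinkSpace G F :=
  linkUnitary (g ∘ t) (g ∘ s)

/-- The coherent group average `∫ U(g) dg` over the gauge transformations at the vertices in `S`,
on the kinematical Hilbert space `L²(G ^ E)`. -/
def coherentAverage (L : Lattice V E) (S : Finset V) : LinkSpace G E →L[ℂ] LinkSpace G E :=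
  strongAverage (haarPi G S) fun g => gaugeUnitary L.src L.tgt (extendOne S g)

variable {L : Lattice V E} (R : Region L)

/-- The bulk vertices that do not lie on the corner. -/
def offCorner : Finset V := L.bulk \ R.cornerV

/-- `H_F^phys`: wave functions of the links in `F` that satisfy the Gauss law at all bulk vertices
that do not lie on the corner. -/
def physSpace (F : Finset E) : Submodule ℂ (LinkSpace G F) where
  carrier := {φ | ∀ g : offCorner R → G,
    gaugeUnitary (fun e : F => L.src e) (fun e : F => L.tgt e) (extendOne (offCorner R) g) φ = φ}
  add_mem' := fun ha hb g => by rw [map_add, ha g, hb g]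
  zero_mem' := fun g => map_zero _
  smul_mem' := fun c _ ha g => by rw [map_smul, ha g]

/-- The projector from `L²(G ^ E)` onto the space of states on which the gauge constraints are
implemented everywhere except on the corner. -/
def offCornerProj : LinkSpace G E →L[ℂ] LinkSpace G E := coherentAverage L (offCorner R)

/-- The projector `Π^phys_∂Σ`: coherent average over the gauge transformations at the corner. -/
def cornerProj : LinkSpace G E →L[ℂ] LinkSpace G E := coherentAverage L R.cornerV

/-! ### Kinematical and relational subsystem algebras -/

/-- `ψ = φ ⊗ χ`, with `φ` a wave function of the links in `F` and `χ` one of the other links. -/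
def IsProduct (F : Finset E) (φ : LinkSpace G F) (χ : LinkSpace G (Fᶜ : Finset E))
    (ψ : LinkSpace G E) : Prop :=
  ψ =ᵐ[haarPi G E] fun x => φ (fun e => x e) * χ (fun e => x e)

/-- The algebra `A_S = B(H_S^phys)` of the subsystem `S` with edges `F`, acting as `f ⊗ 1` on
`H_S^phys ⊗ H_rest^phys`, the space of states on which the gauge constraints are implemented
everywhere except on the corner. This space is a subspace of `L²(G ^ E)`, with projector
`P = offCornerProj R`, and operators on it are identified with operators `X` on `L²(G ^ E)` such
that `X P = X = P X`. -/
def subsystemAlgebra (F : Finset E) : Set (LinkSpace G E →L[ℂ] LinkSpace G E) :=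
  {X | X ∘L offCornerProj R = X ∧ offCornerProj R ∘L X = X ∧
    ∃ f : physSpace (G := G) R F →L[ℂ] physSpace (G := G) R F,
      ∀ (φ : physSpace (G := G) R F) (χ : physSpace (G := G) R (Fᶜ : Finset E))
        (ψ : LinkSpace G E), IsProduct F φ.1 χ.1 ψ → IsProduct F (f φ).1 χ.1 (X ψ)}

/-- The elements of `A_S` that are invariant under all gauge transformations at the corner. -/
def invariantSubsystemAlgebra (F : Finset E) : Set (LinkSpace G E →L[ℂ] LinkSpace G E) :=
  {X | X ∈ subsystemAlgebra R F ∧ ∀ g : R.cornerV → G,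
    gaugeUnitary L.src L.tgt (extendOne R.cornerV g) ∘L X =
      X ∘L gaugeUnitary L.src L.tgt (extendOne R.cornerV g)}

variable {R} (Φ : ExtrinsicFrame R)

/-- The orientation of the frame in a link configuration: the holonomies of its Wilson lines. The
orientation states `|g⟩_Φ` are the (generalised) eigenstates of these holonomies. -/
def ExtrinsicFrame.orientation (x : E → G) : R.cornerV → G := fun v => holonomy x (Φ.line v)

/-- The group elements `h k⁻¹` on the corner, at the endpoints `s e` of the edges of the region, where
`h` is the orientation of the frame in the configuration `x`; `1` at edges off the region. -/
def ExtrinsicFrame.control (k : R.cornerV → G) (s : E → V) (x : E → G) : E → G := fun e =>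
  if e ∈ R.cornerE ∪ R.interiorE then extendOne R.cornerV (Φ.orientation x * k⁻¹) (s e) else 1

theorem measurable_holonomy (p : List (OrientedEdge E)) :
    Measurable fun x : E → G => holonomy x p := by
  induction p with
  | nil => exact measurable_const
  | cons d p ih =>
    obtain ⟨e, b⟩ := d
    cases b
    · exact ih.mul (measurable_pi_apply e).inv
    · exact ih.mul (measurable_pi_apply e)

theorem holonomy_congr {x y : E → G} (p : List (OrientedEdge E)) (h : ∀ d ∈ p, x d.1 = y d.1) :
    holonomy x p = holonomy y p := by
  induction p with
  | nil => rfl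
  | cons d p ih =>
    have h1 := h d (by simp)
    have h2 := ih fun d' hd' => h d' (by simp [hd'])
    obtain ⟨e, b⟩ := d
    cases b <;> simp_all [holonomy]

theorem ExtrinsicFrame.measurable_control (k : R.cornerV → G) (s : E → V) :
    Measurable (Φ.control k s) := by
  refine measurable_pi_lambda _ fun e => ?_
  unfold ExtrinsicFrame.control extendOne
  split_ifs
  · exact (measurable_holonomy _).mul measurable_const
  · exact measurable_const
  · exact measurable_const

theorem ExtrinsicFrame.control_congr (k : R.cornerV → G) (s : E → V) {x y : E → G}
    (h : ∀ e ∉ R.cornerE ∪ R.interiorE, x e = y e) : Φ.control k s x = Φ.control k s y := by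
  have : Φ.orientation x = Φ.orientation y := by
    funext v
    refine holonomy_congr _ fun d hd => h _ ?_
    have := Φ.exterior v d hd
    simp [this.1, this.2]
  unfold ExtrinsicFrame.control
  rw [this]

theorem ExtrinsicFrame.measurePreserving_dress (k : R.cornerV → G) :
    MeasurePreserving
      (fun x : E → G => linkTranslate (Φ.control k L.tgt x)⁻¹ (Φ.control k L.src x)⁻¹ x)
      (haarPi G E) (haarPi G E) :=
  measurePreserving_controlled (R.cornerE ∪ R.interiorE) (fun x => (Φ.control k L.tgt x)⁻¹)
    (fun x => (Φ.control k L.src x)⁻¹) (Φ.measurable_control k L.tgt).inv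
    (Φ.measurable_control k L.src).inv
    (fun x e he => by simp [ExtrinsicFrame.control, he])
    (fun x e he => by simp [ExtrinsicFrame.control, he])
    (fun x y h => by simp only [Φ.control_congr k L.tgt h])
    (fun x y h => by simp only [Φ.control_congr k L.src h])

/-- The controlled gauge transformation `∫ dh |h⟩⟨h|_Φ ⊗ U_Σ(h k⁻¹)`, where `U_Σ` is the action of the
corner gauge group on the links of the region: on wave functions, `ψ` goes to
`x ↦ (U_Σ(h k⁻¹) ψ)(x)` with `h` the orientation of the frame in the configuration `x`. -/
def ExtrinsicFrame.dress (k : R.cornerV → G) : LinkSpace G E →L[ℂ] LinkSpace G E :=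
  (Lp.compMeasurePreservingₗᵢ ℂ
    (fun x : E → G => linkTranslate (Φ.control k L.tgt x)⁻¹ (Φ.control k L.src x)⁻¹ x)
    (Φ.measurePreserving_dress k)).toContinuousLinearMap

/-- The relational observable of `X` relative to the frame in orientation `k`, that is, the twirl
`∫ dg U(g) (|k⟩⟨k|_Φ ⊗ X) U(g)†` over the corner gauge group. By `U(g) |k⟩_Φ = |g k⟩_Φ` it equals
`∫ dh |h⟩⟨h|_Φ ⊗ U_Σ(h k⁻¹) X U_Σ(h k⁻¹)†` for observables `X` of the region, which is the conjugate
of `X` by the controlled gauge transformation. -/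
def ExtrinsicFrame.relationalObservable (k : R.cornerV → G)
    (X : LinkSpace G E →L[ℂ] LinkSpace G E) : LinkSpace G E →L[ℂ] LinkSpace G E :=
  Φ.dress k ∘L X ∘L ContinuousLinearMap.adjoint (Φ.dress k)

/-- The relational algebra `A^phys_{S|Φ}` of the subsystem `S` with edges `F`: relational observables
of elements of `A_S`, represented on the physical Hilbert space. -/
def ExtrinsicFrame.relationalAlgebra (k : R.cornerV → G) (F : Finset E) :
    Set (LinkSpace G E →L[ℂ] LinkSpace G E) :=
  (fun X => Φ.relationalObservable k X ∘L cornerProj R) '' subsystemAlgebra R F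

/-- Values of `h` on the edges which a Wilson line of the frame uses first, in direction `b`
(`true` if along the orientation of the edge); `1` on all other edges. -/
def ExtrinsicFrame.onFirstEdges (b : Bool) (h : R.cornerV → G) : E → G := by
  classical
  exact fun e =>
    if hv : ∃ v, (Φ.line v).head? = some (e, b) then h hv.choose else 1

/-- The frame reorientation `V_Φ(h)`, `|g⟩_Φ ↦ |g h⁻¹⟩_Φ`: it acts on the first edge `e` of the Wilson
line of `v`, which is incident to the global boundary, by `V_e(h_v)` if `e` points away from the
anchor and by `U_e(h_v)` otherwise. -/
def ExtrinsicFrame.reorientation (h : R.cornerV → G) : LinkSpace G E →L[ℂ] LinkSpace G E :=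
  linkUnitary (Φ.onFirstEdges false h) (Φ.onFirstEdges true h)

/-- The incoherent twirl over the reorientation group of the frame. -/
def ExtrinsicFrame.reorientationTwirl :
    (LinkSpace G E →L[ℂ] LinkSpace G E) → (LinkSpace G E →L[ℂ] LinkSpace G E) :=
  twirl (haarPi G R.cornerV) Φ.reorientation

end Gauge

end LatticeGauge

end

open LatticeGauge

noncomputable section

namespace LatticeGauge

universe u v w

open scoped InnerProductSpace ComplexConjugate

/-! Write Π for `cornerProj R`, U(g) for the corner gauge transformations, D for the dressing
`Φ.dress k` and V(h) for the reorientations of Φ. A relational observable is a conjugate D X D†,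
with X in the subsystem algebra. All the sets in the theorem are shown to equal A^G Π, where A^G is
the invariant subsystem algebra; this set refers to no frame and no orientation.

Three facts carry the proof. (1) Π absorbs every U(g), so Π X Π = T(X) Π with T the incoherent
average over the corner gauge group, and T maps the subsystem algebra onto A^G
(`gaugeProj_comp_comp_gaugeProj`, `ActsAs.gaugeTwirl`). (2) D gauge transforms the links of the
region by a parameter read off from links outside it. An invariant X therefore commutes with D and
is its own relational observable (`dress_comp_of_invariant`). (3) Moving V(h) past D replaces k by k
h⁻¹, which amounts to inserting U(k h k⁻¹) together with a transformation of exterior links. The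
latter and V(h) commute with X, so conjugating D X D† Π by V(h) turns X into U X U†. Averaging over
h gives D T(X) D† Π = T(X) Π (`reorientationTwirl_relationalObservable`).

For the intersection, V(h) leaves the holonomies of a non-overlapping Φ' unchanged, hence commutes
with every observable relative to Φ'. An element of both algebras thus equals its own twirl over the
reorientations of Φ, and by (3) it lies in A^G Π.

The technical point is that X is f ⊗ P, not f ⊗ 1, with P the projector onto the physical states of
the other links. No off-corner vertex touches both the subsystem and its complement
(`separatedBy_subsystemEdges`), so `offCornerProj R` is a tensor product of projectors
(`gaugeProj_linkTensor`). Commutation of X with controlled maps is then checked on matrix elements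
between product states, which are total (`ActsAs.commute_koopman`). -/

/-! ### Composition operators -/

section Koopman

variable {A B C : Type*} [MeasurableSpace A] [MeasurableSpace B] [MeasurableSpace C]
  {μ : Measure A} {ν : Measure B} {ρ : Measure C}

/-- The isometry `ψ ↦ ψ ∘ T` of `L²` given by a measure preserving map `T`. -/
abbrev koopman (T : A → B) (hT : MeasurePreserving T μ ν) : Lp ℂ 2 ν →L[ℂ] Lp ℂ 2 μ :=
  (Lp.compMeasurePreservingₗᵢ ℂ T hT).toContinuousLinearMap

theorem coeFn_koopman (T : A → B) (hT : MeasurePreserving T μ ν) (φ : Lp ℂ 2 ν) :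
    koopman T hT φ =ᵐ[μ] φ ∘ T := Lp.coeFn_compMeasurePreserving φ hT

theorem koopman_congr {S T : A → B} (hS : MeasurePreserving S μ ν) (hT : MeasurePreserving T μ ν)
    (h : S = T) : koopman S hS = koopman T hT := by subst h; rfl

theorem koopman_comp (S : A → B) (hS : MeasurePreserving S μ ν) (T : B → C)
    (hT : MeasurePreserving T ν ρ) :
    koopman S hS ∘L koopman T hT = koopman (T ∘ S) (hT.comp hS) := by
  ext1 φ
  exact (Lp.compMeasurePreserving_comp_apply φ hT hS).symm

theorem koopman_id (hT : MeasurePreserving (fun x : A => x) μ μ) :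
    koopman (fun x : A => x) hT = ContinuousLinearMap.id ℂ _ := by
  ext1 φ
  exact Lp.compMeasurePreserving_id_apply φ

theorem koopman_commute {S T : A → A} (hS : MeasurePreserving S μ μ) (hT : MeasurePreserving T μ μ)
    (h : ∀ x, T (S x) = S (T x)) :
    koopman S hS ∘L koopman T hT = koopman T hT ∘L koopman S hS := by
  rw [koopman_comp, koopman_comp]
  exact koopman_congr _ _ (funext h)

theorem adjoint_koopman_comp_self (T : A → B) (hT : MeasurePreserving T μ ν) :
    ContinuousLinearMap.adjoint (koopman T hT) ∘L koopman T hT = ContinuousLinearMap.id ℂ _ := by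
  rw [← ContinuousLinearMap.one_def, ← ContinuousLinearMap.norm_map_iff_adjoint_comp_self]
  exact fun φ => (Lp.compMeasurePreservingₗᵢ ℂ T hT).norm_map φ

/-- The adjoint of the composition operator of an invertible map is that of the inverse. -/
theorem adjoint_koopman {S : B → A} {T : A → B} (hS : MeasurePreserving S ν μ)
    (hT : MeasurePreserving T μ ν) (h : ∀ x, S (T x) = x) :
    ContinuousLinearMap.adjoint (koopman T hT) = koopman S hS := by
  -- Composition operators reverse the order, so `S ∘ T = id` gives the isometry of `T` a right
  -- inverse. It is then unitary, and its adjoint is that right inverse.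
  have h1 : koopman T hT ∘L koopman S hS = ContinuousLinearMap.id ℂ _ := by
    rw [koopman_comp, ← koopman_id (MeasurePreserving.id μ)]
    exact koopman_congr _ _ (funext h)
  calc ContinuousLinearMap.adjoint (koopman T hT)
      = ContinuousLinearMap.adjoint (koopman T hT) ∘L (koopman T hT ∘L koopman S hS) := by
        rw [h1, ContinuousLinearMap.comp_id]
    _ = koopman S hS := by
        rw [← ContinuousLinearMap.comp_assoc, adjoint_koopman_comp_self,
          ContinuousLinearMap.id_comp]

theorem koopman_comp_adjoint {S : B → A} {T : A → B} (hS : MeasurePreserving S ν μ)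
    (hT : MeasurePreserving T μ ν) (h : ∀ x, S (T x) = x) :
    koopman T hT ∘L ContinuousLinearMap.adjoint (koopman T hT) = ContinuousLinearMap.id ℂ _ := by
  rw [adjoint_koopman hS hT h, koopman_comp, ← koopman_id (MeasurePreserving.id μ)]
  exact koopman_congr _ _ (funext h)

end Koopman

/-! ### Tensor products of wave functions -/

section Tensor

variable {A B C : Type*} [MeasurableSpace A] [MeasurableSpace B] [MeasurableSpace C]
  {μ : Measure A} {ν : Measure B} {ρ : Measure C} [IsProbabilityMeasure μ] [IsProbabilityMeasure ν]
  [IsProbabilityMeasure ρ]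

theorem memLp_two_mul_prod {φ : A → ℂ} {χ : B → ℂ} (hφ : MemLp φ 2 μ) (hχ : MemLp χ 2 ν) :
    MemLp (fun z : A × B => φ z.1 * χ z.2) 2 (μ.prod ν) := by
  have hm : AEStronglyMeasurable (fun z : A × B => φ z.1 * χ z.2) (μ.prod ν) :=
    hφ.1.comp_fst.mul hχ.1.comp_snd
  rw [memLp_two_iff_integrable_sq_norm hm]
  have h := ((memLp_two_iff_integrable_sq_norm hφ.1).1 hφ).mul_prod
    ((memLp_two_iff_integrable_sq_norm hχ.1).1 hχ)
  refine h.congr (Filter.Eventually.of_forall fun z => ?_)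
  simp [mul_pow]

variable (π : C ≃ᵐ A × B) (hπ : MeasurePreserving π ρ (μ.prod ν))

/-- The wave function `φ ⊗ χ` on `C ≃ A × B`. -/
def tensorLp (φ : Lp ℂ 2 μ) (χ : Lp ℂ 2 ν) : Lp ℂ 2 ρ :=
  koopman π hπ ((memLp_two_mul_prod (Lp.memLp φ) (Lp.memLp χ)).toLp _)

theorem coeFn_tensorLp (φ : Lp ℂ 2 μ) (χ : Lp ℂ 2 ν) :
    tensorLp π hπ φ χ =ᵐ[ρ] fun c => φ (π c).1 * χ (π c).2 :=
  (coeFn_koopman _ hπ _).trans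
    (hπ.quasiMeasurePreserving.ae_eq_comp (MemLp.coeFn_toLp _))

theorem tensorLp_eq_of_ae {φ : Lp ℂ 2 μ} {χ : Lp ℂ 2 ν} {ψ : Lp ℂ 2 ρ}
    (h : ψ =ᵐ[ρ] fun c => φ (π c).1 * χ (π c).2) : ψ = tensorLp π hπ φ χ :=
  Lp.ext (h.trans (coeFn_tensorLp π hπ φ χ).symm)

theorem ae_fst (π : C ≃ᵐ A × B) (hπ : MeasurePreserving π ρ (μ.prod ν))
    {p : A → Prop} (h : ∀ᵐ a ∂μ, p a) : ∀ᵐ c ∂ρ, p (π c).1 :=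
  hπ.quasiMeasurePreserving.ae (Measure.quasiMeasurePreserving_fst.ae h)

theorem ae_snd (π : C ≃ᵐ A × B) (hπ : MeasurePreserving π ρ (μ.prod ν))
    {p : B → Prop} (h : ∀ᵐ b ∂ν, p b) : ∀ᵐ c ∂ρ, p (π c).2 :=
  hπ.quasiMeasurePreserving.ae (Measure.quasiMeasurePreserving_snd.ae h)

theorem tensorLp_add_left (φ φ' : Lp ℂ 2 μ) (χ : Lp ℂ 2 ν) :
    tensorLp π hπ (φ + φ') χ = tensorLp π hπ φ χ + tensorLp π hπ φ' χ := by
  refine Lp.ext ?_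
  filter_upwards [coeFn_tensorLp π hπ (φ + φ') χ, coeFn_tensorLp π hπ φ χ,
    coeFn_tensorLp π hπ φ' χ, Lp.coeFn_add (tensorLp π hπ φ χ) (tensorLp π hπ φ' χ),
    ae_fst π hπ (Lp.coeFn_add φ φ')] with c h1 h2 h3 h4 h5
  rw [h1, h4, Pi.add_apply, h2, h3, h5, Pi.add_apply, add_mul]

theorem tensorLp_smul_left (a : ℂ) (φ : Lp ℂ 2 μ) (χ : Lp ℂ 2 ν) :
    tensorLp π hπ (a • φ) χ = a • tensorLp π hπ φ χ := by
  refine Lp.ext ?_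
  filter_upwards [coeFn_tensorLp π hπ (a • φ) χ, coeFn_tensorLp π hπ φ χ,
    Lp.coeFn_smul a (tensorLp π hπ φ χ), ae_fst π hπ (Lp.coeFn_smul a φ)] with c h1 h2 h3 h4
  rw [h1, h3, Pi.smul_apply, h2, h4, Pi.smul_apply, smul_eq_mul, smul_eq_mul, mul_assoc]

theorem tensorLp_add_right (φ : Lp ℂ 2 μ) (χ χ' : Lp ℂ 2 ν) :
    tensorLp π hπ φ (χ + χ') = tensorLp π hπ φ χ + tensorLp π hπ φ χ' := by
  refine Lp.ext ?_
  filter_upwards [coeFn_tensorLp π hπ φ (χ + χ'), coeFn_tensorLp π hπ φ χ,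
    coeFn_tensorLp π hπ φ χ', Lp.coeFn_add (tensorLp π hπ φ χ) (tensorLp π hπ φ χ'),
    ae_snd π hπ (Lp.coeFn_add χ χ')] with c h1 h2 h3 h4 h5
  rw [h1, h4, Pi.add_apply, h2, h3, h5, Pi.add_apply, mul_add]

theorem tensorLp_smul_right (a : ℂ) (φ : Lp ℂ 2 μ) (χ : Lp ℂ 2 ν) :
    tensorLp π hπ φ (a • χ) = a • tensorLp π hπ φ χ := by
  refine Lp.ext ?_
  filter_upwards [coeFn_tensorLp π hπ φ (a • χ), coeFn_tensorLp π hπ φ χ,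
    Lp.coeFn_smul a (tensorLp π hπ φ χ), ae_snd π hπ (Lp.coeFn_smul a χ)] with c h1 h2 h3 h4
  rw [h1, h3, Pi.smul_apply, h2, h4, Pi.smul_apply, smul_eq_mul, smul_eq_mul, mul_left_comm]

/-- Matrix elements of a composition operator between product states, for a map of skew product form
`(x, y) ↦ (τ_y x, T' y)`. -/
theorem inner_tensorLp_koopman {T : C → C} (hT : MeasurePreserving T ρ ρ) (τ : B → A → A)
    (hτ : ∀ y, MeasurePreserving (τ y) μ μ) (T' : B → B)
    (h1 : ∀ c, (π (T c)).1 = τ (π c).2 (π c).1) (h2 : ∀ c, (π (T c)).2 = T' (π c).2)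
    (φ φ' : Lp ℂ 2 μ) (χ χ' : Lp ℂ 2 ν) :
    ⟪tensorLp π hπ φ' χ', koopman T hT (tensorLp π hπ φ χ)⟫_ℂ =
      ∫ y, conj (χ' y) * χ (T' y) * ⟪φ', koopman (τ y) (hτ y) φ⟫_ℂ ∂ν := by
  have hint := L2.integrable_inner (𝕜 := ℂ) (tensorLp π hπ φ' χ') (koopman T hT (tensorLp π hπ φ χ))
  rw [L2.inner_def]
  set F : A × B → ℂ := fun z => conj (φ' z.1 * χ' z.2) * (φ (τ z.2 z.1) * χ (T' z.2)) with hF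
  have hae : (fun c => ⟪tensorLp π hπ φ' χ' c, koopman T hT (tensorLp π hπ φ χ) c⟫_ℂ) =ᵐ[ρ]
      F ∘ π := by
    filter_upwards [coeFn_tensorLp π hπ φ' χ', coeFn_koopman T hT (tensorLp π hπ φ χ),
      hT.quasiMeasurePreserving.ae (coeFn_tensorLp π hπ φ χ)] with c e1 e2 e3
    rw [e1, e2, Function.comp, e3, h1, h2]
    simp [hF, RCLike.inner_apply, mul_comm]
  -- Fubini needs integrability on the product. It comes from the pointwise inner product of two
  -- `L²` functions, which is integrable.
  have hFint : Integrable F (μ.prod ν) :=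
    (hπ.integrable_comp_emb π.measurableEmbedding).1 (hint.congr hae)
  rw [integral_congr_ae hae]
  calc ∫ c, (F ∘ π) c ∂ρ = ∫ z, F z ∂(μ.prod ν) := hπ.integral_comp π.measurableEmbedding F
    -- The first factor is integrated at fixed `y`, where the skew map acts on it by the single
    -- transformation `τ y`.
    _ = ∫ y, ∫ x, F (x, y) ∂μ ∂ν := integral_prod_symm _ hFint
    _ = _ := by
      refine integral_congr_ae (Filter.Eventually.of_forall fun y => ?_)
      simp only
      rw [L2.inner_def, ← integral_const_mul]
      refine integral_congr_ae ?_
      filter_upwards [coeFn_koopman (τ y) (hτ y) φ] with x hx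
      rw [hx]
      simp only [hF, RCLike.inner_apply, map_mul, Function.comp]
      ring

theorem inner_tensorLp (φ φ' : Lp ℂ 2 μ) (χ χ' : Lp ℂ 2 ν) :
    ⟪tensorLp π hπ φ' χ', tensorLp π hπ φ χ⟫_ℂ = ⟪φ', φ⟫_ℂ * ⟪χ', χ⟫_ℂ := by
  have h := inner_tensorLp_koopman π hπ (MeasurePreserving.id ρ) (fun _ x => x)
    (fun _ => MeasurePreserving.id μ) (fun y => y) (fun _ => rfl) (fun _ => rfl) φ φ' χ χ'
  have e1 : koopman id (MeasurePreserving.id ρ) (tensorLp π hπ φ χ) = tensorLp π hπ φ χ :=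
    Lp.compMeasurePreserving_id_apply _
  have e2 : koopman (fun x => x) (MeasurePreserving.id μ) φ = φ :=
    Lp.compMeasurePreserving_id_apply _
  rw [e1, e2, integral_mul_const] at h
  rw [h, L2.inner_def (𝕜 := ℂ) χ', mul_comm]
  congr 1
  refine integral_congr_ae (Filter.Eventually.of_forall fun y => ?_)
  simp [RCLike.inner_apply, mul_comm]

theorem norm_tensorLp (φ : Lp ℂ 2 μ) (χ : Lp ℂ 2 ν) : ‖tensorLp π hπ φ χ‖ = ‖φ‖ * ‖χ‖ := by
  have h := inner_tensorLp π hπ φ φ χ χ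
  rw [inner_self_eq_norm_sq_to_K, inner_self_eq_norm_sq_to_K, inner_self_eq_norm_sq_to_K] at h
  have h' : ‖tensorLp π hπ φ χ‖ ^ 2 = (‖φ‖ * ‖χ‖) ^ 2 := by
    rw [mul_pow]; exact_mod_cast h
  exact (pow_left_inj₀ (norm_nonneg _) (by positivity) two_ne_zero).1 h'

/-- `φ ↦ φ ⊗ χ` as a bounded operator. -/
def tensorLeft (χ : Lp ℂ 2 ν) : Lp ℂ 2 μ →L[ℂ] Lp ℂ 2 ρ :=
  LinearMap.mkContinuous
    { toFun := fun φ => tensorLp π hπ φ χ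
      map_add' := fun φ φ' => tensorLp_add_left π hπ φ φ' χ
      map_smul' := fun a φ => tensorLp_smul_left π hπ a φ χ } ‖χ‖
    fun φ => by
      simp only [LinearMap.coe_mk, AddHom.coe_mk]
      rw [norm_tensorLp, mul_comm]

@[simp] theorem tensorLeft_apply (χ : Lp ℂ 2 ν) (φ : Lp ℂ 2 μ) :
    tensorLeft π hπ χ φ = tensorLp π hπ φ χ := rfl

/-- `χ ↦ φ ⊗ χ` as a bounded operator. -/
def tensorRight (φ : Lp ℂ 2 μ) : Lp ℂ 2 ν →L[ℂ] Lp ℂ 2 ρ :=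
  LinearMap.mkContinuous
    { toFun := fun χ => tensorLp π hπ φ χ
      map_add' := fun χ χ' => tensorLp_add_right π hπ φ χ χ'
      map_smul' := fun a χ => tensorLp_smul_right π hπ a φ χ } ‖φ‖
    fun χ => by
      simp only [LinearMap.coe_mk, AddHom.coe_mk]
      rw [norm_tensorLp]

@[simp] theorem tensorRight_apply (φ : Lp ℂ 2 μ) (χ : Lp ℂ 2 ν) :
    tensorRight π hπ φ χ = tensorLp π hπ φ χ := rfl

/-- Product maps act factorwise on product states. -/
theorem koopman_tensorLp {T : C → C} (hT : MeasurePreserving T ρ ρ) {τ : A → A}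
    (hτ : MeasurePreserving τ μ μ) {T' : B → B} (hT' : MeasurePreserving T' ν ν)
    (h1 : ∀ c, (π (T c)).1 = τ (π c).1) (h2 : ∀ c, (π (T c)).2 = T' (π c).2)
    (φ : Lp ℂ 2 μ) (χ : Lp ℂ 2 ν) :
    koopman T hT (tensorLp π hπ φ χ) = tensorLp π hπ (koopman τ hτ φ) (koopman T' hT' χ) := by
  refine tensorLp_eq_of_ae π hπ ?_
  filter_upwards [coeFn_koopman T hT (tensorLp π hπ φ χ),
    hT.quasiMeasurePreserving.ae (coeFn_tensorLp π hπ φ χ), ae_fst π hπ (coeFn_koopman τ hτ φ),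
    ae_snd π hπ (coeFn_koopman T' hT' χ)] with c e1 e2 e3 e4
  rw [e1, Function.comp, e2, e3, e4, h1, h2, Function.comp, Function.comp]

/-- Product states are total. -/
theorem eq_zero_of_inner_tensorLp_eq_zero (ψ : Lp ℂ 2 ρ)
    (h : ∀ (φ : Lp ℂ 2 μ) (χ : Lp ℂ 2 ν), ⟪tensorLp π hπ φ χ, ψ⟫_ℂ = 0) : ψ = 0 := by
  have hψ : Integrable ψ ρ := (Lp.memLp ψ).integrable (by norm_num)
  -- Indicators of rectangles are product states. Rectangles form a π-system that generates the
  -- product σ-algebra, so the vanishing extends to all measurable sets.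
  have key : ∀ s : Set (A × B), MeasurableSet s → ∫ c in π ⁻¹' s, ψ c ∂ρ = 0 := by
    intro s hs
    induction s, hs using MeasurableSpace.induction_on_inter generateFrom_prod.symm
      isPiSystem_prod with
    | empty => simp
    | basic s hs =>
      obtain ⟨s, hs, t, ht, rfl⟩ := hs
      have e : tensorLp π hπ (indicatorConstLp 2 hs (measure_ne_top μ s) (1 : ℂ))
          (indicatorConstLp 2 ht (measure_ne_top ν t) (1 : ℂ)) =
          indicatorConstLp 2 (π.measurable (hs.prod ht)) (measure_ne_top ρ _) (1 : ℂ) := by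
        refine (tensorLp_eq_of_ae π hπ ?_).symm
        filter_upwards [ae_fst π hπ (indicatorConstLp_coeFn (p := 2) (hs := hs)
            (hμs := measure_ne_top μ s) (c := (1 : ℂ))),
          ae_snd π hπ (indicatorConstLp_coeFn (p := 2) (hs := ht)
            (hμs := measure_ne_top ν t) (c := (1 : ℂ))),
          indicatorConstLp_coeFn (p := 2) (hs := π.measurable (hs.prod ht))
            (hμs := measure_ne_top ρ _) (c := (1 : ℂ))] with c e1 e2 e3
        rw [e1, e2, e3]
        by_cases c1 : (π c).1 ∈ s <;> by_cases c2 : (π c).2 ∈ t <;> simp [Set.indicator, c1, c2]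
      have h' := h (indicatorConstLp 2 hs (measure_ne_top μ s) (1 : ℂ))
        (indicatorConstLp 2 ht (measure_ne_top ν t) (1 : ℂ))
      rw [e, L2.inner_indicatorConstLp_one] at h'
      exact h'
    | compl s hs ih =>
      rw [Set.preimage_compl, setIntegral_compl (π.measurable hs) hψ, ih, sub_zero]
      have huniv : tensorLp π hπ (indicatorConstLp 2 MeasurableSet.univ (measure_ne_top μ _) (1 : ℂ))
          (indicatorConstLp 2 MeasurableSet.univ (measure_ne_top ν _) (1 : ℂ)) =
          indicatorConstLp 2 MeasurableSet.univ (measure_ne_top ρ _) (1 : ℂ) := by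
        refine (tensorLp_eq_of_ae π hπ ?_).symm
        filter_upwards [ae_fst π hπ (indicatorConstLp_coeFn (p := 2) (hs := MeasurableSet.univ)
            (hμs := measure_ne_top μ _) (c := (1 : ℂ))),
          ae_snd π hπ (indicatorConstLp_coeFn (p := 2) (hs := MeasurableSet.univ)
            (hμs := measure_ne_top ν _) (c := (1 : ℂ))),
          indicatorConstLp_coeFn (p := 2) (hs := MeasurableSet.univ)
            (hμs := measure_ne_top ρ _) (c := (1 : ℂ))] with c e1 e2 e3
        rw [e1, e2, e3]; simp
      have h' := h (indicatorConstLp 2 MeasurableSet.univ (measure_ne_top μ _) (1 : ℂ))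
        (indicatorConstLp 2 MeasurableSet.univ (measure_ne_top ν _) (1 : ℂ))
      rw [huniv, L2.inner_indicatorConstLp_one] at h'
      simpa using h'
    | iUnion s hd hs ih =>
      rw [Set.preimage_iUnion, integral_iUnion (fun i => π.measurable (hs i))
        (fun i j hij => (hd hij).preimage _) hψ.integrableOn]
      simp [ih]
  have h0 : ψ =ᵐ[ρ] 0 := by
    refine Integrable.ae_eq_zero_of_forall_setIntegral_eq_zero hψ fun s hs _ => ?_
    have := key (π.symm ⁻¹' s) (π.symm.measurable hs)
    rwa [← Set.preimage_comp, MeasurableEquiv.symm_comp_self, Set.preimage_id] at this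
  exact (Lp.eq_zero_iff_ae_eq_zero).2 h0

/-- Vectors are determined by their inner products with product states. -/
theorem ext_inner_tensorLp {ψ ψ' : Lp ℂ 2 ρ}
    (h : ∀ (φ : Lp ℂ 2 μ) (χ : Lp ℂ 2 ν),
      ⟪tensorLp π hπ φ χ, ψ⟫_ℂ = ⟪tensorLp π hπ φ χ, ψ'⟫_ℂ) : ψ = ψ' :=
  sub_eq_zero.1 <| eq_zero_of_inner_tensorLp_eq_zero π hπ _ fun φ χ => by
    rw [inner_sub_right, h, sub_self]

/-- Bounded operators are determined by their values on product states. -/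
theorem clm_ext_tensorLp {X Y : Lp ℂ 2 ρ →L[ℂ] Lp ℂ 2 ρ}
    (h : ∀ (φ : Lp ℂ 2 μ) (χ : Lp ℂ 2 ν), X (tensorLp π hπ φ χ) = Y (tensorLp π hπ φ χ)) : X = Y := by
  -- For the adjoints, the hypothesis becomes equality of inner products with product states, to
  -- which totality applies.
  refine ContinuousLinearMap.adjoint.injective ?_
  ext1 ψ
  refine ext_inner_tensorLp π hπ fun φ χ => ?_
  rw [ContinuousLinearMap.adjoint_inner_right, ContinuousLinearMap.adjoint_inner_right, h]

end Tensor

/-! ### Link translations and strong averages -/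

section Links

variable {G : Type u} [Group G] [TopologicalSpace G] [IsTopologicalGroup G] [CompactSpace G]
  [T2Space G] [SecondCountableTopology G] [MeasurableSpace G] [BorelSpace G]

theorem linkTranslate_linkTranslate {ι : Type v} (a b a' b' : ι → G) (x : ι → G) :
    linkTranslate a b (linkTranslate a' b' x) = linkTranslate (a * a') (b * b') x := by
  funext e
  simp [linkTranslate, mul_assoc]

theorem linkTranslate_one {ι : Type v} (x : ι → G) : linkTranslate 1 1 x = x := by
  funext e
  simp [linkTranslate]

variable {ι : Type v} [Fintype ι]

theorem linkUnitary_eq_koopman (a b : ι → G) :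
    linkUnitary a b = koopman (linkTranslate a⁻¹ b⁻¹) (measurePreserving_linkTranslate a⁻¹ b⁻¹) :=
  rfl

theorem linkUnitary_comp (a b a' b' : ι → G) :
    linkUnitary a b ∘L linkUnitary a' b' = linkUnitary (a * a') (b * b') := by
  rw [linkUnitary_eq_koopman, linkUnitary_eq_koopman, koopman_comp]
  refine koopman_congr _ _ (funext fun x => ?_)
  rw [Function.comp, linkTranslate_linkTranslate, mul_inv_rev, mul_inv_rev]

theorem linkUnitary_one : linkUnitary (1 : ι → G) 1 = ContinuousLinearMap.id ℂ _ := by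
  rw [← koopman_id (MeasurePreserving.id _)]
  refine koopman_congr _ _ (funext fun x => ?_)
  simp only [inv_one]
  exact linkTranslate_one x

theorem adjoint_linkUnitary (a b : ι → G) :
    ContinuousLinearMap.adjoint (linkUnitary a b) = linkUnitary a⁻¹ b⁻¹ := by
  refine adjoint_koopman _ _ fun x => ?_
  rw [linkTranslate_linkTranslate]
  simp [linkTranslate_one]

theorem norm_linkUnitary_le (a b : ι → G) : ‖linkUnitary a b‖ ≤ 1 :=
  LinearIsometry.norm_toContinuousLinearMap_le _

/-- Strong continuity of translations: a jointly continuous family of maps is continuous into `C(ι →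
G, ι → G)`, and composition with measure preserving maps is continuous on `L²` in that topology. All
averages below rely on it for integrability. -/
theorem continuous_linkUnitary {Z : Type*} [TopologicalSpace Z] {a b : Z → ι → G}
    {ψ : Z → LinkSpace G ι} (ha : Continuous a) (hb : Continuous b) (hψ : Continuous ψ) :
    Continuous fun z => linkUnitary (a z) (b z) (ψ z) := by
  have hc : Continuous fun p : Z × (ι → G) => linkTranslate (a p.1)⁻¹ (b p.1)⁻¹ p.2 := by
    unfold linkTranslate
    fun_prop
  let T : C(Z × (ι → G), ι → G) := ⟨_, hc⟩
  exact hψ.compMeasurePreservingLp T.curry.continuous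
    (fun z => measurePreserving_linkTranslate (a z)⁻¹ (b z)⁻¹) (by simp)

/-- Continuous functions on a compact group are integrable, so the default value `0` of
`strongAverage` does not occur. -/
theorem strongAverage_apply {H : Type w} [NormedAddCommGroup H] [NormedSpace ℂ H] [CompleteSpace H]
    {A : (ι → G) → H →L[ℂ] H} (hA : ∀ φ, Continuous fun k => A k φ) {C : ℝ} (hC : ∀ k, ‖A k‖ ≤ C)
    (φ : H) : strongAverage (haarPi G ι) A φ = ∫ k, A k φ ∂(haarPi G ι) := by
  have h : (∀ φ, Integrable (fun k => A k φ) (haarPi G ι)) ∧ ∃ C : ℝ, ∀ k, ‖A k‖ ≤ C :=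
    ⟨fun φ => (hA φ).integrable_of_hasCompactSupport (HasCompactSupport.of_compactSpace _), C, hC⟩
  unfold strongAverage
  rw [dif_pos h]
  rfl

end Links

/-! ### Gauge projections and twirls -/

section GaugeOps

variable {G : Type u} [Group G] [TopologicalSpace G] [IsTopologicalGroup G] [CompactSpace G]
  [T2Space G] [SecondCountableTopology G] [MeasurableSpace G] [BorelSpace G]
  {V : Type v} [Fintype V] [DecidableEq V] {F : Type w} [Fintype F]

theorem gaugeUnitary_comp (s t : F → V) (γ γ' : V → G) :
    gaugeUnitary s t γ ∘L gaugeUnitary s t γ' = gaugeUnitary s t (γ * γ') :=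
  linkUnitary_comp _ _ _ _

theorem gaugeUnitary_apply_apply (s t : F → V) (γ γ' : V → G) (φ : LinkSpace G F) :
    gaugeUnitary s t γ (gaugeUnitary s t γ' φ) = gaugeUnitary s t (γ * γ') φ :=
  DFunLike.congr_fun (gaugeUnitary_comp s t γ γ') φ

theorem gaugeUnitary_one (s t : F → V) :
    gaugeUnitary s t (1 : V → G) = ContinuousLinearMap.id ℂ _ := linkUnitary_one

theorem gaugeUnitary_one_apply (s t : F → V) (φ : LinkSpace G F) :
    gaugeUnitary s t (1 : V → G) φ = φ := by
  rw [gaugeUnitary_one]; rfl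

theorem adjoint_gaugeUnitary (s t : F → V) (γ : V → G) :
    ContinuousLinearMap.adjoint (gaugeUnitary s t γ) = gaugeUnitary s t γ⁻¹ :=
  adjoint_linkUnitary _ _

theorem gaugeUnitary_congr {s t : F → V} {γ γ' : V → G} (hs : ∀ e, γ (s e) = γ' (s e))
    (ht : ∀ e, γ (t e) = γ' (t e)) : gaugeUnitary s t γ = gaugeUnitary s t γ' := by
  have h1 : γ ∘ t = γ' ∘ t := funext ht
  have h2 : γ ∘ s = γ' ∘ s := funext hs
  rw [gaugeUnitary, gaugeUnitary, h1, h2]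

theorem norm_gaugeUnitary_le (s t : F → V) (γ : V → G) : ‖gaugeUnitary s t γ‖ ≤ 1 :=
  norm_linkUnitary_le _ _

theorem extendOne_mul (S : Finset V) (g h : S → G) :
    extendOne S (g * h) = extendOne S g * extendOne S h := by
  funext v
  by_cases hv : v ∈ S <;> simp [extendOne, hv]

theorem extendOne_one (S : Finset V) : extendOne S (1 : S → G) = 1 := by
  funext v
  by_cases hv : v ∈ S <;> simp [extendOne, hv]

theorem extendOne_inv (S : Finset V) (g : S → G) : extendOne S g⁻¹ = (extendOne S g)⁻¹ := by
  funext v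
  by_cases hv : v ∈ S <;> simp [extendOne, hv]

theorem extendOne_of_notMem {S : Finset V} (g : S → G) {v : V} (hv : v ∉ S) :
    extendOne S g v = 1 := by simp [extendOne, hv]

theorem continuous_extendOne (S : Finset V) : Continuous (extendOne S : (S → G) → V → G) := by
  refine continuous_pi fun v => ?_
  by_cases hv : v ∈ S <;> simp only [extendOne, hv, dite_true, dite_false] <;> fun_prop

theorem continuous_gaugeUnitary {Z : Type*} [TopologicalSpace Z] (s t : F → V) {γ : Z → V → G}
    {ψ : Z → LinkSpace G F} (hγ : Continuous γ) (hψ : Continuous ψ) :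
    Continuous fun z => gaugeUnitary s t (γ z) (ψ z) :=
  continuous_linkUnitary (continuous_pi fun e => (continuous_apply (t e)).comp hγ)
    (continuous_pi fun e => (continuous_apply (s e)).comp hγ) hψ

variable (s t : F → V) (S : Finset V)

/-- The gauge transformation by `g` at the vertices in `S`. -/
abbrev gaugeAt (g : S → G) : LinkSpace G F →L[ℂ] LinkSpace G F := gaugeUnitary s t (extendOne S g)

theorem gaugeAt_apply_apply (g h : S → G) (φ : LinkSpace G F) :
    gaugeAt s t S g (gaugeAt s t S h φ) = gaugeAt s t S (g * h) φ := by
  rw [gaugeAt, gaugeAt, gaugeUnitary_apply_apply, ← extendOne_mul]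

theorem gaugeAt_one_apply (φ : LinkSpace G F) : gaugeAt s t S (1 : S → G) φ = φ := by
  rw [gaugeAt, extendOne_one, gaugeUnitary_one_apply]

theorem adjoint_gaugeAt (g : S → G) :
    ContinuousLinearMap.adjoint (gaugeAt s t S g) = gaugeAt s t S g⁻¹ := by
  rw [gaugeAt, adjoint_gaugeUnitary, ← extendOne_inv]

/-- The coherent average over the gauge transformations at the vertices in `S`. -/
def gaugeProj : LinkSpace G F →L[ℂ] LinkSpace G F :=
  strongAverage (haarPi G S) (gaugeAt s t S)

theorem gaugeProj_apply (φ : LinkSpace G F) :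
    gaugeProj s t S φ = ∫ g : S → G, gaugeAt s t S g φ ∂(haarPi G S) :=
  strongAverage_apply (fun _ => continuous_gaugeUnitary s t (continuous_extendOne S) continuous_const)
    (fun _ => norm_gaugeUnitary_le s t _) φ

theorem integrable_gaugeAt (φ : LinkSpace G F) :
    Integrable (fun g : S → G => gaugeAt s t S g φ) (haarPi G S) :=
  (continuous_gaugeUnitary s t (continuous_extendOne S)
    continuous_const).integrable_of_hasCompactSupport (HasCompactSupport.of_compactSpace _)

theorem gaugeAt_gaugeProj (h : S → G) (φ : LinkSpace G F) :
    gaugeAt s t S h (gaugeProj s t S φ) = gaugeProj s t S φ := by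
  rw [gaugeProj_apply, ← ContinuousLinearMap.integral_comp_comm _ (integrable_gaugeAt s t S φ)]
  simp only [gaugeAt_apply_apply]
  exact integral_mul_left_eq_self (fun g : S → G => gaugeAt s t S g φ) h

theorem gaugeProj_gaugeAt (h : S → G) (φ : LinkSpace G F) :
    gaugeProj s t S (gaugeAt s t S h φ) = gaugeProj s t S φ := by
  rw [gaugeProj_apply, gaugeProj_apply]
  simp only [gaugeAt_apply_apply]
  exact integral_mul_right_eq_self (fun g : S → G => gaugeAt s t S g φ) h

theorem gaugeProj_of_fixed {φ : LinkSpace G F} (h : ∀ g : S → G, gaugeAt s t S g φ = φ) :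
    gaugeProj s t S φ = φ := by
  rw [gaugeProj_apply]
  simp [h]

theorem inner_gaugeProj_left (φ ψ : LinkSpace G F) :
    ⟪gaugeProj s t S φ, ψ⟫_ℂ = ⟪φ, gaugeProj s t S ψ⟫_ℂ := by
  -- Each adjoint `gaugeAt g⁻¹` fixes the projected vector, so averaging the right argument changes
  -- nothing. Conjugate symmetry then moves the projector across.
  have key : ∀ φ ψ : LinkSpace G F,
      ⟪gaugeProj s t S φ, gaugeProj s t S ψ⟫_ℂ = ⟪gaugeProj s t S φ, ψ⟫_ℂ := by
    intro φ ψ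
    rw [gaugeProj_apply s t S ψ, ← integral_inner (integrable_gaugeAt s t S ψ)]
    have : ∀ g : S → G, ⟪gaugeProj s t S φ, gaugeAt s t S g ψ⟫_ℂ = ⟪gaugeProj s t S φ, ψ⟫_ℂ := by
      intro g
      rw [← ContinuousLinearMap.adjoint_inner_left, adjoint_gaugeAt, gaugeAt_gaugeProj]
    simp [this]
  rw [← key, ← inner_conj_symm, key, inner_conj_symm]

theorem commute_gaugeProj {X : LinkSpace G F →L[ℂ] LinkSpace G F}
    (hX : ∀ g : S → G, gaugeAt s t S g ∘L X = X ∘L gaugeAt s t S g) :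
    gaugeProj s t S ∘L X = X ∘L gaugeProj s t S := by
  ext1 φ
  rw [ContinuousLinearMap.comp_apply, ContinuousLinearMap.comp_apply, gaugeProj_apply,
    gaugeProj_apply, ← ContinuousLinearMap.integral_comp_comm _ (integrable_gaugeAt s t S φ)]
  exact integral_congr_ae (Filter.Eventually.of_forall fun g => DFunLike.congr_fun (hX g) φ)

/-- The incoherent average over the gauge transformations at the vertices in `S`. -/
def gaugeTwirl (X : LinkSpace G F →L[ℂ] LinkSpace G F) : LinkSpace G F →L[ℂ] LinkSpace G F :=
  twirl (haarPi G S) (gaugeAt s t S) X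

variable (X : LinkSpace G F →L[ℂ] LinkSpace G F)

theorem continuous_conj_gaugeAt (φ : LinkSpace G F) :
    Continuous fun g : S → G => gaugeAt s t S g (X (gaugeAt s t S g⁻¹ φ)) :=
  continuous_gaugeUnitary s t (continuous_extendOne S)
    (X.continuous.comp (continuous_gaugeUnitary s t ((continuous_extendOne S).comp continuous_inv)
      continuous_const))

theorem integrable_conj_gaugeAt (φ : LinkSpace G F) :
    Integrable (fun g : S → G => gaugeAt s t S g (X (gaugeAt s t S g⁻¹ φ))) (haarPi G S) :=
  (continuous_conj_gaugeAt s t S X φ).integrable_of_hasCompactSupport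
    (HasCompactSupport.of_compactSpace _)

theorem norm_conj_gaugeAt_le (g : S → G) :
    ‖gaugeAt s t S g ∘L X ∘L ContinuousLinearMap.adjoint (gaugeAt s t S g)‖ ≤ ‖X‖ := by
  rw [adjoint_gaugeAt]
  calc _ ≤ ‖gaugeAt s t S g‖ * (‖X‖ * ‖gaugeAt s t S g⁻¹‖) :=
        (ContinuousLinearMap.opNorm_comp_le _ _).trans (mul_le_mul_of_nonneg_left
          (ContinuousLinearMap.opNorm_comp_le _ _) (norm_nonneg _))
    _ ≤ 1 * (‖X‖ * 1) := by
        gcongr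
        · exact norm_gaugeUnitary_le s t _
        · exact norm_gaugeUnitary_le s t _
    _ = ‖X‖ := by ring

theorem gaugeTwirl_apply (φ : LinkSpace G F) :
    gaugeTwirl s t S X φ =
      ∫ g : S → G, gaugeAt s t S g (X (gaugeAt s t S g⁻¹ φ)) ∂(haarPi G S) := by
  rw [gaugeTwirl, twirl, strongAverage_apply (C := ‖X‖) _ (norm_conj_gaugeAt_le s t S X)]
  · simp only [ContinuousLinearMap.comp_apply, adjoint_gaugeAt]
    rfl
  · intro φ
    simp only [ContinuousLinearMap.comp_apply, adjoint_gaugeAt]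
    exact continuous_conj_gaugeAt s t S X φ

theorem gaugeAt_comp_gaugeTwirl (h : S → G) :
    gaugeAt s t S h ∘L gaugeTwirl s t S X = gaugeTwirl s t S X ∘L gaugeAt s t S h := by
  ext1 φ
  rw [ContinuousLinearMap.comp_apply, ContinuousLinearMap.comp_apply, gaugeTwirl_apply,
    gaugeTwirl_apply, ← ContinuousLinearMap.integral_comp_comm _ (integrable_conj_gaugeAt s t S X φ)]
  -- The substitution `g ↦ h * g` cancels the `h` acting first on `φ` and leaves `h` on the outside.
  conv_rhs => rw [← integral_mul_left_eq_self _ h]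
  refine integral_congr_ae (Filter.Eventually.of_forall fun g => ?_)
  simp only [gaugeAt_apply_apply]
  rw [mul_inv_rev, inv_mul_cancel_right]

theorem gaugeTwirl_of_commute
    (hX : ∀ g : S → G, gaugeAt s t S g ∘L X = X ∘L gaugeAt s t S g) :
    gaugeTwirl s t S X = X := by
  ext1 φ
  rw [gaugeTwirl_apply]
  have : ∀ g : S → G, gaugeAt s t S g (X (gaugeAt s t S g⁻¹ φ)) = X φ := by
    intro g
    have := DFunLike.congr_fun (hX g) (gaugeAt s t S g⁻¹ φ)
    rw [ContinuousLinearMap.comp_apply, ContinuousLinearMap.comp_apply] at this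
    rw [this, gaugeAt_apply_apply, mul_inv_cancel, gaugeAt_one_apply]
  simp [this]

/-- The right-hand projector absorbs the `g⁻¹` inside the twirl, leaving only the average of
`gaugeAt g` on the left, which is the projector. This turns coherent averaging on both sides into
incoherent averaging. -/
theorem gaugeProj_comp_comp_gaugeProj :
    gaugeProj s t S ∘L X ∘L gaugeProj s t S = gaugeTwirl s t S X ∘L gaugeProj s t S := by
  ext1 φ
  simp only [ContinuousLinearMap.comp_apply]
  rw [gaugeTwirl_apply, gaugeProj_apply s t S (X _)]
  simp only [gaugeAt_gaugeProj]

end GaugeOps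

/-! ### Splitting the links into a subsystem and its complement -/

section Split

variable {G : Type u} [Group G] [TopologicalSpace G] [IsTopologicalGroup G] [CompactSpace G]
  [T2Space G] [SecondCountableTopology G] [MeasurableSpace G] [BorelSpace G]
  {V : Type v} [Fintype V] [DecidableEq V] {E : Type w} [Fintype E] [DecidableEq E]

/-- Splitting a configuration into its restrictions to `F` and to the complement of `F`. -/
def splitLinks (F : Finset E) : (E → G) ≃ᵐ (F → G) × ((Fᶜ : Finset E) → G) where
  toFun x := (fun e => x e, fun e => x e)
  invFun y := fun e =>
    if h : e ∈ F then y.1 ⟨e, h⟩ else y.2 ⟨e, Finset.mem_compl.2 h⟩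
  left_inv x := by
    funext e
    by_cases h : e ∈ F <;> simp [h]
  right_inv y := by
    refine Prod.ext (funext fun e => ?_) (funext fun e => ?_)
    · simp
    · have := Finset.mem_compl.1 e.2
      simp [this]
  measurable_toFun := by
    refine Measurable.prodMk ?_ ?_ <;>
      exact measurable_pi_lambda _ fun e => measurable_pi_apply (e : E)
  measurable_invFun := by
    refine measurable_pi_lambda _ fun e => ?_
    by_cases h : e ∈ F
    · simpa [h, Function.comp_def] using (measurable_pi_apply (⟨e, h⟩ : F)).comp measurable_fst
    · simpa [h, Function.comp_def] using
        (measurable_pi_apply (⟨e, Finset.mem_compl.2 h⟩ : (Fᶜ : Finset E))).comp measurable_snd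

theorem measurePreserving_splitLinks (F : Finset E) :
    MeasurePreserving (splitLinks F) (haarPi G E)
      ((haarPi G F).prod (haarPi G (Fᶜ : Finset E))) := by
  have h1 := measurePreserving_piEquivPiSubtypeProd (fun _ : E => haarProb G) (fun e => e ∈ F)
  let c : {e // ¬ e ∈ F} ≃ (Fᶜ : Finset E) :=
    Equiv.subtypeEquivRight fun e => Finset.mem_compl.symm
  have h2 := measurePreserving_piCongrLeft (fun _ : (Fᶜ : Finset E) => haarProb G) c
  have h3 := ((MeasurePreserving.id _).prod h2).comp h1
  -- The two sides differ only in the `Fintype` instance on the elements of `F`.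
  have h4 : (haarPi G F).prod (haarPi G (Fᶜ : Finset E)) =
      (@Measure.pi _ _ (Subtype.fintype _) _ fun _ : {e // e ∈ F} => haarProb G).prod
        (haarPi G (Fᶜ : Finset E)) := by congr!
  rw [h4]
  convert! h3 using 1

/-- The product state `φ ⊗ χ` of a wave function of the links in `F` and one of the others. -/
abbrev linkTensor (F : Finset E) (φ : LinkSpace G F) (χ : LinkSpace G (Fᶜ : Finset E)) :
    LinkSpace G E := tensorLp (splitLinks F) (measurePreserving_splitLinks F) φ χ

theorem isProduct_iff {F : Finset E} {φ : LinkSpace G F} {χ : LinkSpace G (Fᶜ : Finset E)}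
    {ψ : LinkSpace G E} : IsProduct F φ χ ψ ↔ ψ = linkTensor F φ χ :=
  ⟨fun h => tensorLp_eq_of_ae _ _ h, fun h => h ▸ coeFn_tensorLp _ _ φ χ⟩

variable (L : Lattice V E) (F : Finset E)

theorem gaugeUnitary_linkTensor (γ : V → G) (φ : LinkSpace G F)
    (χ : LinkSpace G (Fᶜ : Finset E)) :
    gaugeUnitary L.src L.tgt γ (linkTensor F φ χ) =
      linkTensor F (gaugeUnitary (fun e : F => L.src e) (fun e : F => L.tgt e) γ φ)
        (gaugeUnitary (fun e : (Fᶜ : Finset E) => L.src e) (fun e : (Fᶜ : Finset E) => L.tgt e)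
          γ χ) :=
  koopman_tensorLp _ _ (measurePreserving_linkTranslate _ _) (measurePreserving_linkTranslate _ _)
    (measurePreserving_linkTranslate _ _) (fun _ => rfl) (fun _ => rfl) φ χ

/-- No vertex in `S` is incident both to an edge in `F` and to an edge outside `F`. -/
def SeparatedBy (S : Finset V) : Prop :=
  ∀ v ∈ S, ∀ e e', L.src e = v ∨ L.tgt e = v → L.src e' = v ∨ L.tgt e' = v → e ∈ F → e' ∈ F

variable {L F} {S : Finset V}

/-- Under separation, a gauge transformation of the first factor alone comes from one of the whole
lattice, which the projector absorbs. -/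
theorem gaugeProj_linkTensor_gaugeAt_left (h : SeparatedBy L F S) (g : S → G) (φ : LinkSpace G F)
    (χ : LinkSpace G (Fᶜ : Finset E)) :
    gaugeProj L.src L.tgt S (linkTensor F
      (gaugeAt (fun e : F => L.src e) (fun e : F => L.tgt e) S g φ) χ) =
      gaugeProj L.src L.tgt S (linkTensor F φ χ) := by
  classical
  -- Switching `g` off at vertices that touch no edge of `F` does not change its action on `F`. By
  -- separation, the remaining vertices touch no edge outside `F`.
  let g' : S → G := fun v => if ∃ e ∈ F, L.src e = v ∨ L.tgt e = v then g v else 1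
  rw [← gaugeProj_gaugeAt L.src L.tgt S g' (linkTensor F φ χ), gaugeAt, gaugeAt,
    gaugeUnitary_linkTensor]
  have h1 : ∀ v, (∃ e ∈ F, L.src e = v ∨ L.tgt e = v) → extendOne S g v = extendOne S g' v := by
    intro v hv
    by_cases hS : v ∈ S
    · simp only [extendOne, hS, dite_true, g', hv, if_true]
    · simp [extendOne, hS]
  have h2 : ∀ v, (∃ e ∉ F, L.src e = v ∨ L.tgt e = v) → extendOne S g' v = 1 := by
    rintro v ⟨e, he, hev⟩
    by_cases hS : v ∈ S
    · have : ¬ ∃ e ∈ F, L.src e = v ∨ L.tgt e = v := fun ⟨e', he', hev'⟩ =>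
        he (h v hS e' e hev' hev he')
      simp only [extendOne, hS, dite_true, g', this, if_false]
    · simp [extendOne, hS]
  rw [gaugeUnitary_congr (F := F) (fun e => h1 _ ⟨e, e.2, Or.inl rfl⟩)
      (fun e => h1 _ ⟨e, e.2, Or.inr rfl⟩),
    gaugeUnitary_congr (F := (Fᶜ : Finset E)) (γ := extendOne S g') (γ' := 1)
      (fun e => h2 _ ⟨e, Finset.mem_compl.1 e.2, Or.inl rfl⟩)
      (fun e => h2 _ ⟨e, Finset.mem_compl.1 e.2, Or.inr rfl⟩), gaugeUnitary_one_apply]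

/-- The gauge projection factorises if no vertex is incident to both factors. -/
theorem gaugeProj_linkTensor (h : SeparatedBy L F S) (φ : LinkSpace G F)
    (χ : LinkSpace G (Fᶜ : Finset E)) :
    gaugeProj L.src L.tgt S (linkTensor F φ χ) =
      linkTensor F (gaugeProj (fun e : F => L.src e) (fun e : F => L.tgt e) S φ)
        (gaugeProj (fun e : (Fᶜ : Finset E) => L.src e) (fun e : (Fᶜ : Finset E) => L.tgt e)
          S χ) := by
  have hr : ∀ (g : S → G) (φ : LinkSpace G F) (χ : LinkSpace G (Fᶜ : Finset E)),
      gaugeProj L.src L.tgt S (linkTensor F φ (gaugeAt (fun e : (Fᶜ : Finset E) => L.src e)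
        (fun e : (Fᶜ : Finset E) => L.tgt e) S g χ)) =
      gaugeProj L.src L.tgt S (linkTensor F φ χ) := by
    intro g φ χ
    -- Since `g` on the first factor can be inserted freely, `g` on the second factor alone may be
    -- completed to `g` on both, which the projector absorbs.
    rw [← gaugeProj_linkTensor_gaugeAt_left h g, ← gaugeProj_gaugeAt L.src L.tgt S g
      (linkTensor F φ χ)]
    congr 1
    exact (gaugeUnitary_linkTensor L F (extendOne S g) φ χ).symm
  have hl : gaugeProj L.src L.tgt S (linkTensor F φ χ) = gaugeProj L.src L.tgt S (linkTensor F
      (gaugeProj (fun e : F => L.src e) (fun e : F => L.tgt e) S φ) χ) := by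
    rw [gaugeProj_apply (fun e : F => L.src e), linkTensor, linkTensor, ← tensorLeft_apply _ _ χ (∫ _, _ ∂_),
      ← ContinuousLinearMap.integral_comp_comm _ (integrable_gaugeAt _ _ S φ),
      ← ContinuousLinearMap.integral_comp_comm _
        ((tensorLeft _ _ χ).integrable_comp (integrable_gaugeAt _ _ S φ))]
    simp only [tensorLeft_apply, gaugeProj_linkTensor_gaugeAt_left h]
    simp
  have hl' : ∀ φ : LinkSpace G F, gaugeProj L.src L.tgt S (linkTensor F φ χ) =
      gaugeProj L.src L.tgt S (linkTensor F φ (gaugeProj (fun e : (Fᶜ : Finset E) => L.src e)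
        (fun e : (Fᶜ : Finset E) => L.tgt e) S χ)) := by
    intro φ
    rw [gaugeProj_apply (fun e : (Fᶜ : Finset E) => L.src e), linkTensor, linkTensor,
      ← tensorRight_apply _ _ φ (∫ _, _ ∂_),
      ← ContinuousLinearMap.integral_comp_comm _ (integrable_gaugeAt _ _ S χ),
      ← ContinuousLinearMap.integral_comp_comm _
        ((tensorRight _ _ φ).integrable_comp (integrable_gaugeAt _ _ S χ))]
    simp only [tensorRight_apply, hr]
    simp
  rw [hl, hl']
  -- With both factors projected, the product state is already gauge invariant.
  refine gaugeProj_of_fixed _ _ _ fun g => ?_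
  rw [gaugeAt, gaugeUnitary_linkTensor]
  congr 1
  · exact gaugeAt_gaugeProj _ _ S g φ
  · exact gaugeAt_gaugeProj _ _ S g χ

end Split

/-! ### The subsystem algebras -/

section Algebra

variable {G : Type u} [Group G] [TopologicalSpace G] [IsTopologicalGroup G] [CompactSpace G]
  [T2Space G] [SecondCountableTopology G] [MeasurableSpace G] [BorelSpace G]
  {V : Type v} [Fintype V] [DecidableEq V] {E : Type w} [Fintype E] [DecidableEq E]
  {L : Lattice V E} (R : Region L) (F : Finset E)

/-- The projector from `L²(G ^ F)` onto `H_F^phys`. -/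
def physProj : LinkSpace G F →L[ℂ] LinkSpace G F :=
  gaugeProj (fun e : F => L.src e) (fun e : F => L.tgt e) (offCorner R)

theorem physProj_mem (φ : LinkSpace G F) : physProj R F φ ∈ physSpace (G := G) R F :=
  fun g => gaugeAt_gaugeProj _ _ _ g φ

theorem physProj_of_mem {φ : LinkSpace G F} (h : φ ∈ physSpace (G := G) R F) :
    physProj R F φ = φ := gaugeProj_of_fixed _ _ _ h

theorem physProj_physProj (φ : LinkSpace G F) : physProj R F (physProj R F φ) = physProj R F φ :=
  physProj_of_mem R F (physProj_mem R F φ)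

theorem inner_physProj_left (φ ψ : LinkSpace G F) :
    ⟪physProj R F φ, ψ⟫_ℂ = ⟪φ, physProj R F ψ⟫_ℂ := inner_gaugeProj_left _ _ _ φ ψ

variable {R F}

theorem offCornerProj_linkTensor (hF : SeparatedBy L F (offCorner R)) (φ : LinkSpace G F)
    (χ : LinkSpace G (Fᶜ : Finset E)) :
    offCornerProj R (linkTensor F φ χ) = linkTensor F (physProj R F φ) (physProj R Fᶜ χ) :=
  gaugeProj_linkTensor hF φ χ

theorem inner_offCornerProj_left (φ ψ : LinkSpace G E) :
    ⟪offCornerProj R φ, ψ⟫_ℂ = ⟪φ, offCornerProj R ψ⟫_ℂ := inner_gaugeProj_left _ _ _ φ ψ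

variable (R) in
/-- `X = f ⊗ P`, where `f` is an operator of the links in `F` supported on `H_F^phys` and `P` is the
projector onto the physical states of the other links. -/
structure ActsAs (f : LinkSpace G F →L[ℂ] LinkSpace G F) (X : LinkSpace G E →L[ℂ] LinkSpace G E) :
    Prop where
  proj_left : ∀ φ, physProj R F (f φ) = f φ
  proj_right : ∀ φ, f (physProj R F φ) = f φ
  apply_tensor : ∀ φ χ, X (linkTensor F φ χ) = linkTensor F (f φ) (physProj R Fᶜ χ)

/-- An operator on the physical space extends to all wave functions of `F` by precomposition with
`physProj`. The condition `X P = X` then fixes `X` on all product states, not only on physical ones,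
because `P` factorises. -/
theorem mem_subsystemAlgebra_iff (hF : SeparatedBy L F (offCorner R))
    {X : LinkSpace G E →L[ℂ] LinkSpace G E} :
    X ∈ subsystemAlgebra R F ↔ ∃ f, ActsAs R (F := F) f X := by
  constructor
  · rintro ⟨h1, -, f, hf⟩
    refine ⟨(physSpace (G := G) R F).subtypeL ∘L f ∘L
      (physProj R F).codRestrict (physSpace (G := G) R F) (physProj_mem R F), ?_, ?_, ?_⟩
    · exact fun φ => physProj_of_mem R F (f _).2
    · intro φ
      have : (physProj R F).codRestrict (physSpace (G := G) R F) (physProj_mem R F)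
          (physProj R F φ) = (physProj R F).codRestrict (physSpace (G := G) R F)
          (physProj_mem R F) φ := Subtype.ext (physProj_physProj R F φ)
      simp only [ContinuousLinearMap.comp_apply, this]
    · intro φ χ
      rw [← h1, ContinuousLinearMap.comp_apply, offCornerProj_linkTensor hF]
      exact isProduct_iff.1 (hf ⟨_, physProj_mem R F φ⟩ ⟨_, physProj_mem R Fᶜ χ⟩ _
        (isProduct_iff.2 rfl))
  · rintro ⟨f, h1, h2, h3⟩
    refine ⟨?_, ?_, (f ∘L (physSpace (G := G) R F).subtypeL).codRestrict (physSpace (G := G) R F)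
      (fun φ => h1 φ ▸ physProj_mem R F (f φ)), ?_⟩
    · refine clm_ext_tensorLp _ (measurePreserving_splitLinks F) fun φ χ => ?_
      rw [ContinuousLinearMap.comp_apply, offCornerProj_linkTensor hF, h3, h3, h2,
        physProj_physProj]
    · refine clm_ext_tensorLp _ (measurePreserving_splitLinks F) fun φ χ => ?_
      rw [ContinuousLinearMap.comp_apply, h3, offCornerProj_linkTensor hF, h1,
        physProj_physProj]
    · intro φ χ ψ hψ
      rw [isProduct_iff.1 hψ]
      refine isProduct_iff.2 ?_
      rw [h3, physProj_of_mem R Fᶜ χ.2]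
      rfl

theorem ActsAs.adjoint_apply_tensor {f : LinkSpace G F →L[ℂ] LinkSpace G F}
    {X : LinkSpace G E →L[ℂ] LinkSpace G E} (h : ActsAs R f X) (φ : LinkSpace G F)
    (χ : LinkSpace G (Fᶜ : Finset E)) :
    ContinuousLinearMap.adjoint X (linkTensor F φ χ) =
      linkTensor F (ContinuousLinearMap.adjoint f φ) (physProj R Fᶜ χ) := by
  refine ext_inner_tensorLp _ (measurePreserving_splitLinks F) fun φ' χ' => ?_
  rw [ContinuousLinearMap.adjoint_inner_right, h.apply_tensor, inner_tensorLp, inner_tensorLp,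
    ContinuousLinearMap.adjoint_inner_right, inner_physProj_left]

/-- An element `f ⊗ P` of the subsystem algebra commutes with a composition operator of controlled
form if `f` commutes with all the controlled transformations. -/
theorem ActsAs.commute_koopman (hF : SeparatedBy L F (offCorner R))
    {f : LinkSpace G F →L[ℂ] LinkSpace G F}
    {X : LinkSpace G E →L[ℂ] LinkSpace G E} (h : ActsAs R f X)
    {T : (E → G) → E → G} (hT : MeasurePreserving T (haarPi G E) (haarPi G E))
    (τ : ((Fᶜ : Finset E) → G) → (F → G) → F → G)
    (hτ : ∀ y, MeasurePreserving (τ y) (haarPi G F) (haarPi G F))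
    (T' : ((Fᶜ : Finset E) → G) → (Fᶜ : Finset E) → G)
    (h1 : ∀ x, (splitLinks F (T x)).1 = τ (splitLinks F x).2 (splitLinks F x).1)
    (h2 : ∀ x, (splitLinks F (T x)).2 = T' (splitLinks F x).2)
    (hf : ∀ y, f ∘L koopman (τ y) (hτ y) = koopman (τ y) (hτ y) ∘L f)
    (hP : koopman T hT ∘L offCornerProj R = offCornerProj R ∘L koopman T hT) :
    koopman T hT ∘L X = X ∘L koopman T hT := by
  have hf' : ∀ y φ, f (koopman (τ y) (hτ y) φ) = koopman (τ y) (hτ y) (f φ) :=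
    fun y φ => DFunLike.congr_fun (hf y) φ
  have hP' : ∀ φ, koopman T hT (offCornerProj R φ) = offCornerProj R (koopman T hT φ) :=
    fun φ => DFunLike.congr_fun hP φ
  have hXP : ∀ ψ, X (offCornerProj R ψ) = X ψ := fun ψ =>
    DFunLike.congr_fun ((mem_subsystemAlgebra_iff hF).2 ⟨f, h⟩).1 ψ
  refine clm_ext_tensorLp _ (measurePreserving_splitLinks F) fun φ χ => ?_
  refine ext_inner_tensorLp _ (measurePreserving_splitLinks F) fun φ' χ' => ?_
  -- The map `T` need not commute with the projector on the complement alone, only with the total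
  -- one. The total projector is therefore inserted on both sides, so that `χ` and `χ'` appear
  -- projected in both matrix elements, and only `f` and `τ y` remain to be exchanged under the
  -- integral over `y`.
  have e1 : linkTensor F (f φ) (physProj R Fᶜ χ) =
      offCornerProj R (linkTensor F (f φ) (physProj R Fᶜ χ)) := by
    rw [offCornerProj_linkTensor hF, h.proj_left, physProj_physProj]
  rw [ContinuousLinearMap.comp_apply, ContinuousLinearMap.comp_apply, h.apply_tensor, e1, hP',
    ← inner_offCornerProj_left, offCornerProj_linkTensor hF, ← hXP, ← hP',
    offCornerProj_linkTensor hF, ← ContinuousLinearMap.adjoint_inner_left X,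
    h.adjoint_apply_tensor,
    inner_tensorLp_koopman _ _ hT τ hτ T' h1 h2, inner_tensorLp_koopman _ _ hT τ hτ T' h1 h2]
  congr 1
  funext y
  rw [ContinuousLinearMap.adjoint_inner_left, hf', h.proj_right, inner_physProj_left, ← hf',
    h.proj_left]

/-- Operators of the subsystem commute with transformations of the other links. -/
theorem ActsAs.commute_koopman_of_fixed (hF : SeparatedBy L F (offCorner R))
    {f : LinkSpace G F →L[ℂ] LinkSpace G F}
    {X : LinkSpace G E →L[ℂ] LinkSpace G E} (h : ActsAs R f X)
    {T : (E → G) → E → G} (hT : MeasurePreserving T (haarPi G E) (haarPi G E))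
    (T' : ((Fᶜ : Finset E) → G) → (Fᶜ : Finset E) → G)
    (h1 : ∀ x, ∀ e ∈ F, T x e = x e)
    (h2 : ∀ x, (splitLinks F (T x)).2 = T' (splitLinks F x).2)
    (hP : koopman T hT ∘L offCornerProj R = offCornerProj R ∘L koopman T hT) :
    koopman T hT ∘L X = X ∘L koopman T hT :=
  h.commute_koopman hF hT (fun _ x => x) (fun _ => MeasurePreserving.id _) T'
    (fun x => funext fun e => h1 x e e.2) h2
    (fun _ => by rw [koopman_id, ContinuousLinearMap.comp_id, ContinuousLinearMap.id_comp]) hP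

/-- At every vertex one of the two group elements is `1`, so the transformations commute even when
`G` is not abelian. -/
theorem gaugeUnitary_comp_gaugeProj_of_eq_one {F : Type w} [Fintype F] (s t : F → V)
    (S : Finset V) {γ : V → G} (hγ : ∀ v ∈ S, γ v = 1) :
    gaugeProj s t S ∘L gaugeUnitary s t γ = gaugeUnitary s t γ ∘L gaugeProj s t S := by
  refine commute_gaugeProj s t S fun g => ?_
  rw [gaugeAt, gaugeUnitary_comp, gaugeUnitary_comp]
  congr 1
  funext v
  by_cases hv : v ∈ S
  · simp [hγ v hv]
  · simp [extendOne_of_notMem g hv]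

theorem extendOne_cornerV_eq_one (g : R.cornerV → G) : ∀ v ∈ offCorner R, extendOne R.cornerV g v = 1 :=
  fun _ hv => extendOne_of_notMem g (Finset.mem_sdiff.1 hv).2

theorem physProj_gaugeAt (g : R.cornerV → G) (φ : LinkSpace G F) :
    physProj R F (gaugeAt (fun e : F => L.src e) (fun e : F => L.tgt e) R.cornerV g φ) =
      gaugeAt (fun e : F => L.src e) (fun e : F => L.tgt e) R.cornerV g (physProj R F φ) :=
  DFunLike.congr_fun (gaugeUnitary_comp_gaugeProj_of_eq_one _ _ _ (extendOne_cornerV_eq_one g)) φ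

/-- The subsystem algebra is closed under averaging over the corner gauge group. -/
theorem ActsAs.gaugeTwirl {f : LinkSpace G F →L[ℂ] LinkSpace G F}
    {X : LinkSpace G E →L[ℂ] LinkSpace G E} (h : ActsAs R f X) :
    ActsAs R (gaugeTwirl (fun e : F => L.src e) (fun e : F => L.tgt e) R.cornerV f)
      (gaugeTwirl L.src L.tgt R.cornerV X) where
  proj_left φ := by
    rw [gaugeTwirl_apply, ← ContinuousLinearMap.integral_comp_comm _
      (integrable_conj_gaugeAt _ _ R.cornerV f φ)]
    simp only [physProj_gaugeAt, h.proj_left]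
  proj_right φ := by
    rw [gaugeTwirl_apply, gaugeTwirl_apply]
    simp only [← physProj_gaugeAt, h.proj_right]
  apply_tensor φ χ := by
    rw [gaugeTwirl_apply, gaugeTwirl_apply, linkTensor, linkTensor,
      ← tensorLeft_apply _ _ (physProj R Fᶜ χ),
      ← ContinuousLinearMap.integral_comp_comm _ (integrable_conj_gaugeAt _ _ R.cornerV f φ)]
    refine integral_congr_ae (Filter.Eventually.of_forall fun g => ?_)
    simp only [tensorLeft_apply]
    -- On the complement, `g` and `g⁻¹` stand on either side of a projector that commutes with them,
    -- so they cancel; only `f` is conjugated.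
    rw [gaugeAt, gaugeAt, gaugeUnitary_linkTensor, h.apply_tensor, gaugeUnitary_linkTensor,
      ← physProj_gaugeAt, gaugeAt_apply_apply, mul_inv_cancel, gaugeAt_one_apply]

/-- The constant function serves. As a nonzero, fully gauge invariant second factor, it lets
properties of `f ⊗ P` be read back to `f`. -/
theorem exists_gaugeAt_fixed (F : Finset E) : ∃ χ : LinkSpace G F, χ ≠ 0 ∧
    ∀ γ : V → G, gaugeUnitary (fun e : F => L.src e) (fun e : F => L.tgt e) γ χ = χ := by
  refine ⟨(memLp_const (1 : ℂ)).toLp _, ?_, fun γ => ?_⟩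
  · rw [Ne, Lp.eq_zero_iff_ae_eq_zero]
    intro h
    have h' := (memLp_const (μ := haarPi G F) (p := 2) (1 : ℂ)).coeFn_toLp.symm.trans h
    obtain ⟨x, hx⟩ := h'.exists
    simp at hx
  · refine Lp.ext ?_
    have hT := measurePreserving_linkTranslate (γ ∘ (fun e : F => L.tgt e))⁻¹
      (γ ∘ (fun e : F => L.src e))⁻¹
    have h0 := (memLp_const (μ := haarPi G F) (p := 2) (1 : ℂ)).coeFn_toLp
    filter_upwards [coeFn_koopman _ hT ((memLp_const (1 : ℂ)).toLp _),
      hT.quasiMeasurePreserving.ae h0, h0] with x h1 h2 h3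
    rw [h3]
    exact h1.trans h2

/-- If `f ⊗ P` is invariant under the corner gauge group, then so is `f`. -/
theorem ActsAs.commute_gaugeAt {f : LinkSpace G F →L[ℂ] LinkSpace G F}
    {X : LinkSpace G E →L[ℂ] LinkSpace G E} (h : ActsAs R f X) {g : R.cornerV → G}
    (hg : gaugeAt L.src L.tgt R.cornerV g ∘L X = X ∘L gaugeAt L.src L.tgt R.cornerV g) :
    f ∘L gaugeAt (fun e : F => L.src e) (fun e : F => L.tgt e) R.cornerV g =
      gaugeAt (fun e : F => L.src e) (fun e : F => L.tgt e) R.cornerV g ∘L f := by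
  obtain ⟨χ, hχ0, hχ⟩ := exists_gaugeAt_fixed (G := G) (L := L) Fᶜ
  have hq : physProj R Fᶜ χ = χ := physProj_of_mem R Fᶜ fun g => hχ _
  ext1 φ
  have := DFunLike.congr_fun hg (linkTensor F φ χ)
  rw [ContinuousLinearMap.comp_apply, ContinuousLinearMap.comp_apply, h.apply_tensor, gaugeAt,
    gaugeUnitary_linkTensor, gaugeUnitary_linkTensor, h.apply_tensor, hq, hχ, hq] at this
  rw [← sub_eq_zero, ← norm_eq_zero]
  have h0 := congrArg norm (sub_eq_zero.2 this.symm)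
  rw [linkTensor, linkTensor, ← tensorLeft_apply, ← tensorLeft_apply, ← map_sub, tensorLeft_apply,
    norm_tensorLp, norm_zero] at h0
  exact (mul_eq_zero.1 h0).resolve_right (norm_ne_zero_iff.2 hχ0)

end Algebra

/-! ### Geometry of regions and Wilson lines -/

section Geometry

variable {V : Type v} [Fintype V] [DecidableEq V] {E : Type w} [Fintype E] [DecidableEq E]
  {L : Lattice V E} {R : Region L}

theorem subsystemEdges_subset (T : IntrinsicFrame R) (α : Finset RegionalPart) :
    subsystemEdges T α ⊆ R.cornerE ∪ R.interiorE := by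
  refine Finset.biUnion_subset.2 fun p _ => ?_
  cases p
  · exact Finset.subset_union_right
  · exact Finset.sdiff_subset.trans Finset.subset_union_left
  · exact T.tree_subset.trans Finset.subset_union_left

theorem mem_subsystemEdges_of_interior (T : IntrinsicFrame R) (α : Finset RegionalPart) {e : E}
    (he : e ∈ R.interiorE) : e ∈ subsystemEdges T α ↔ .interior ∈ α := by
  have hn : e ∉ R.cornerE := Finset.disjoint_right.1 R.disjointE he
  constructor
  · intro h
    obtain ⟨p, hp, hep⟩ := Finset.mem_biUnion.1 h
    cases p
    · exact hp
    · exact (hn (Finset.mem_sdiff.1 hep).1).elim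
    · exact (hn (T.tree_subset hep)).elim
  · exact fun h => Finset.mem_biUnion.2 ⟨_, h, he⟩

/-- An interior vertex meets only interior edges, and these belong to the subsystem all together or
not at all. Any other off-corner vertex meets no edge of the region. -/
theorem separatedBy_subsystemEdges (T : IntrinsicFrame R) (α : Finset RegionalPart) :
    SeparatedBy L (subsystemEdges T α) (offCorner R) := by
  intro v hv e e' he he' heF
  have hvc : v ∉ R.cornerV := (Finset.mem_sdiff.1 hv).2
  by_cases hvi : v ∈ R.interiorV
  · have hi : ∀ e, L.src e = v ∨ L.tgt e = v → e ∈ R.interiorE := fun e he =>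
      R.interior_incident e (he.imp (fun h => by rwa [h]) (fun h => by rwa [h]))
    rw [mem_subsystemEdges_of_interior T α (hi _ he)] at heF
    rwa [mem_subsystemEdges_of_interior T α (hi _ he')]
  · exfalso
    rcases Finset.mem_union.1 (subsystemEdges_subset T α heF) with h | h
    · have := R.cornerE_ends e h
      rcases he with rfl | rfl
      exacts [hvc this.1, hvc this.2]
    · have := R.interiorE_ends e h
      rcases he with rfl | rfl
      exacts [this.1.elim hvc hvi, this.2.elim hvc hvi]

variable {G : Type u} [Group G] [TopologicalSpace G] [IsTopologicalGroup G] [CompactSpace G]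
  [T2Space G] [SecondCountableTopology G] [MeasurableSpace G] [BorelSpace G]

/-- The factors at intermediate vertices cancel in pairs, and only the two ends of the walk survive.
-/
theorem holonomy_linkTranslate (γ : V → G) (x : E → G) (p : List (OrientedEdge E)) (a b : V)
    (hp : L.IsWalk a p b) :
    holonomy (linkTranslate (γ ∘ L.tgt) (γ ∘ L.src) x) p = γ b * holonomy x p * (γ a)⁻¹ := by
  induction p generalizing a with
  | nil => cases hp; simp [holonomy]
  | cons d p ih =>
    obtain ⟨e, o⟩ := d
    obtain ⟨rfl, hp⟩ := hp
    cases o <;> simp [holonomy, ih _ hp, linkTranslate, Lattice.start, Lattice.finish, mul_assoc]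

theorem notMem_boundary_of_mem_cornerV {v : V} (hv : v ∈ R.cornerV) : v ∉ L.boundary :=
  Finset.disjoint_left.1 R.corner_bulk hv

theorem notMem_boundary_of_mem_offCorner {v : V} (hv : v ∈ offCorner R) : v ∉ L.boundary :=
  Finset.mem_compl.1 (Finset.mem_sdiff.1 hv).1

theorem commute_extendOne (a : R.cornerV → G) (g : offCorner R → G) (v : V) :
    Commute (extendOne R.cornerV a v) (extendOne (offCorner R) g v) := by
  by_cases hv : v ∈ R.cornerV
  · rw [show extendOne (offCorner R) g v = 1 by simp [extendOne, offCorner, hv]]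
    exact Commute.one_right _
  · rw [show extendOne R.cornerV a v = 1 by simp [extendOne, hv]]
    exact Commute.one_left _

/-! ### Frame orientations under gauge transformations and reorientations -/

namespace ExtrinsicFrame

variable (Φ : ExtrinsicFrame R)

theorem orientation_linkTranslate_gauge {γ : V → G} (hc : ∀ v ∈ R.cornerV, γ v = 1)
    (hb : ∀ v ∈ L.boundary, γ v = 1) (x : E → G) :
    Φ.orientation (linkTranslate (γ ∘ L.tgt) (γ ∘ L.src) x) = Φ.orientation x := by
  funext v
  rw [orientation, holonomy_linkTranslate γ x _ _ _ (Φ.isTrail v).1, hc v v.2,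
    hb _ (Φ.anchor_mem v)]
  simp [orientation]

theorem orientation_congr {x y : E → G} (h : ∀ e ∉ R.cornerE ∪ R.interiorE, x e = y e) :
    Φ.orientation x = Φ.orientation y := by
  funext v
  refine holonomy_congr _ fun d hd => h _ ?_
  have := Φ.exterior v d hd
  simp [this.1, this.2]

theorem eq_of_mem_line {v w : R.cornerV} {e : E} {o o' : Bool} (h : (e, o) ∈ Φ.line v)
    (h' : (e, o') ∈ Φ.line w) : v = w := by
  by_contra hvw
  exact Φ.edge_disjoint v w hvw _ h _ h' rfl

theorem onFirstEdges_eq_one {o : Bool} (h : R.cornerV → G) {e : E}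
    (he : ∀ v, (Φ.line v).head? ≠ some (e, o)) : Φ.onFirstEdges o h e = 1 := by
  rw [onFirstEdges, dif_neg]
  exact fun ⟨v, hv⟩ => he v hv

/-- Distinct Wilson lines share no edge, so the vertex chosen in the definition can only be `v`. -/
theorem onFirstEdges_of_head? {o : Bool} (h : R.cornerV → G) {e : E} {v : R.cornerV}
    (hv : (Φ.line v).head? = some (e, o)) : Φ.onFirstEdges o h e = h v := by
  have hex : ∃ v, (Φ.line v).head? = some (e, o) := ⟨v, hv⟩
  rw [onFirstEdges, dif_pos hex]
  congr 1
  exact Φ.eq_of_mem_line (List.mem_of_mem_head? hex.choose_spec) (List.mem_of_mem_head? hv)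

theorem onFirstEdges_eq_one_of_mem_region (o : Bool) (h : R.cornerV → G) {e : E}
    (he : e ∈ R.cornerE ∪ R.interiorE) : Φ.onFirstEdges o h e = 1 := by
  refine Φ.onFirstEdges_eq_one h fun v hv => ?_
  have := Φ.exterior v _ (List.mem_of_mem_head? hv)
  rcases Finset.mem_union.1 he with h | h
  exacts [this.1 h, this.2 h]

theorem start_mem_boundary {v : R.cornerV} {d : OrientedEdge E} (hv : (Φ.line v).head? = some d) :
    L.start d ∈ L.boundary := by
  have h := (Φ.isTrail v).1
  cases hl : Φ.line v with
  | nil => simp [hl] at hv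
  | cons d' p =>
    rw [hl] at h hv
    simp only [List.head?_cons, Option.some.injEq] at hv
    rw [← hv, h.1]
    exact Φ.anchor_mem v

theorem onFirstEdges_eq_one_of_notMem_boundary (o : Bool) (h : R.cornerV → G) {e : E}
    (he : L.start (e, o) ∉ L.boundary) : Φ.onFirstEdges o h e = 1 :=
  Φ.onFirstEdges_eq_one h fun _ hv => he (Φ.start_mem_boundary hv)

/-- The transformation of configurations that implements the frame reorientation by `h⁻¹`. -/
abbrev reorientMap (h : R.cornerV → G) (x : E → G) : E → G :=
  linkTranslate (Φ.onFirstEdges false h)⁻¹ (Φ.onFirstEdges true h)⁻¹ x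

theorem reorientMap_of_ne (h : R.cornerV → G) (x : E → G) {e : E}
    (he : ∀ v o, (Φ.line v).head? ≠ some (e, o)) : Φ.reorientMap h x e = x e := by
  simp [reorientMap, linkTranslate, Φ.onFirstEdges_eq_one h fun v => he v _]

/-- The first edge of a line is the rightmost factor of its holonomy, so a translation on the anchor
side of that edge multiplies the holonomy on the right. -/
theorem orientation_reorientMap (h : R.cornerV → G) (x : E → G) :
    Φ.orientation (Φ.reorientMap h x) = Φ.orientation x * h := by
  funext v
  simp only [orientation, Pi.mul_apply]
  have hw := Φ.isTrail v
  cases hl : Φ.line v with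
  | nil =>
    rw [hl] at hw
    have h1 : Φ.anchor v = v := hw.1
    -- An empty line would have its anchor at the corner vertex `v` itself, but corner vertices are
    -- off the boundary.
    exact (notMem_boundary_of_mem_cornerV v.2 (h1 ▸ Φ.anchor_mem v)).elim
  | cons d p =>
    rw [hl] at hw
    have hnd : d.1 ∉ p.map Prod.fst := (List.nodup_cons.1 hw.2).1
    have hhead : (Φ.line v).head? = some d := by rw [hl]; rfl
    -- An edge of the tail is not the first edge of its own line, which is a trail, nor of another
    -- line, by disjointness.
    have htail : holonomy (Φ.reorientMap h x) p = holonomy x p := by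
      refine holonomy_congr _ fun d' hd' => Φ.reorientMap_of_ne h x fun w o hw' => ?_
      have hmem : (d'.1, d'.2) ∈ Φ.line v := by rw [hl]; exact List.mem_cons_of_mem _ hd'
      obtain rfl := Φ.eq_of_mem_line hmem (List.mem_of_mem_head? hw')
      rw [hhead, Option.some.injEq] at hw'
      exact hnd (hw' ▸ List.mem_map.2 ⟨d', hd', rfl⟩)
    obtain ⟨e, o⟩ := d
    -- Only this line starts with `e`, and it does so in direction `o`, so nothing acts on the far
    -- side of `e`.
    have hopp : Φ.onFirstEdges (!o) h e = 1 := by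
      refine Φ.onFirstEdges_eq_one h fun w hw' => ?_
      obtain rfl := Φ.eq_of_mem_line (List.mem_of_mem_head? hhead) (List.mem_of_mem_head? hw')
      rw [hhead] at hw'
      cases o <;> simp at hw'
    have hdir := Φ.onFirstEdges_of_head? h hhead
    cases o
    · simp only [Bool.not_false] at hopp
      simp [holonomy, htail, reorientMap, linkTranslate, hopp, hdir, mul_assoc]
    · simp only [Bool.not_true] at hopp
      simp [holonomy, htail, reorientMap, linkTranslate, hopp, hdir, mul_assoc]

theorem orientation_reorientMap_of_nonOverlapping {Φ Φ' : ExtrinsicFrame R}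
    (hΦ : NonOverlapping Φ Φ') (h : R.cornerV → G) (x : E → G) :
    Φ'.orientation (Φ.reorientMap h x) = Φ'.orientation x := by
  funext v
  refine holonomy_congr _ fun d hd => Φ.reorientMap_of_ne h x fun w o hw => ?_
  exact hΦ w v _ (List.mem_of_mem_head? hw) d hd rfl

end ExtrinsicFrame

end Geometry

/-! ### Operator identities -/

section Operators

open ContinuousLinearMap

variable {H : Type*} [NormedAddCommGroup H] [InnerProductSpace ℂ H] [CompleteSpace H]

theorem comp_adjoint_of_commute {v D : H →L[ℂ] H} (h : v ∘L D = D ∘L v)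
    (hD : D ∘L adjoint D = .id ℂ H) (hD' : adjoint D ∘L D = .id ℂ H) :
    v ∘L adjoint D = adjoint D ∘L v := by
  calc v ∘L adjoint D = adjoint D ∘L (D ∘L v) ∘L adjoint D := by
        rw [← comp_assoc, ← comp_assoc, hD', id_comp]
    _ = _ := by rw [← h, comp_assoc, hD, comp_id]

/-- Here `v` is a reorientation, `D` the dressing, `U` a corner gauge transformation and `W` its
exterior part undone. Both `v` and `W` pass through `X` and cancel against their adjoints, so only
`U` is left around `X`. -/
theorem conj_conj_of_commute {D P U W X v : H →L[ℂ] H} (hvD : v ∘L D = D ∘L U ∘L W ∘L v)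
    (hP : P ∘L adjoint v = adjoint v ∘L P) (hvX : v ∘L X = X ∘L v) (hWX : W ∘L X = X ∘L W)
    (hvv : v ∘L adjoint v = .id ℂ H) (hWW : W ∘L adjoint W = .id ℂ H) :
    v ∘L ((D ∘L X ∘L adjoint D) ∘L P) ∘L adjoint v =
      D ∘L (U ∘L X ∘L adjoint U) ∘L adjoint D ∘L P := by
  have hadj : adjoint D ∘L adjoint v = adjoint v ∘L adjoint W ∘L adjoint U ∘L adjoint D := by
    rw [← adjoint_comp, hvD]
    simp only [adjoint_comp, comp_assoc]
  calc v ∘L ((D ∘L X ∘L adjoint D) ∘L P) ∘L adjoint v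
      = (v ∘L D) ∘L X ∘L (adjoint D ∘L adjoint v) ∘L P := by
        rw [comp_assoc _ P, hP]
        simp only [comp_assoc]
    _ = D ∘L U ∘L (W ∘L (v ∘L X) ∘L adjoint v ∘L adjoint W) ∘L adjoint U ∘L adjoint D ∘L P := by
        rw [hvD, hadj]
        simp only [comp_assoc]
    _ = _ := by
        rw [hvX, comp_assoc X, ← comp_assoc v, hvv, id_comp, ← comp_assoc W, hWX, comp_assoc X,
          hWW, comp_id]
        simp only [comp_assoc]

theorem commute_conj_comp {D P X v : H →L[ℂ] H} (hvD : v ∘L D = D ∘L v)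
    (hvD' : v ∘L adjoint D = adjoint D ∘L v) (hvX : v ∘L X = X ∘L v) (hvP : v ∘L P = P ∘L v) :
    v ∘L ((D ∘L X ∘L adjoint D) ∘L P) = ((D ∘L X ∘L adjoint D) ∘L P) ∘L v := by
  have h1 : ∀ φ, v (D φ) = D (v φ) := DFunLike.congr_fun hvD
  have h2 : ∀ φ, v (adjoint D φ) = adjoint D (v φ) := DFunLike.congr_fun hvD'
  have h3 : ∀ φ, v (X φ) = X (v φ) := DFunLike.congr_fun hvX
  have h4 : ∀ φ, v (P φ) = P (v φ) := DFunLike.congr_fun hvP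
  ext1 φ
  simp only [comp_apply, h1, h2, h3, h4]

end Operators

/-! ### Dressing and frame reorientations -/

section Frames

variable {G : Type u} [Group G] [TopologicalSpace G] [IsTopologicalGroup G] [CompactSpace G]
  [T2Space G] [SecondCountableTopology G] [MeasurableSpace G] [BorelSpace G]
  {V : Type v} [Fintype V] [DecidableEq V] {E : Type w} [Fintype E] [DecidableEq E]
  {L : Lattice V E} {R : Region L} (Φ : ExtrinsicFrame R)

namespace ExtrinsicFrame

/-- The controlled gauge transformation of configurations that underlies the dressing. -/
abbrev dressMap (k : R.cornerV → G) (x : E → G) : E → G :=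
  linkTranslate (Φ.control k L.tgt x)⁻¹ (Φ.control k L.src x)⁻¹ x

theorem dress_eq_koopman (k : R.cornerV → G) :
    Φ.dress k = koopman (Φ.dressMap k) (Φ.measurePreserving_dress k) := rfl

theorem control_of_notMem (k : R.cornerV → G) (s : E → V) (x : E → G) {e : E}
    (he : e ∉ R.cornerE ∪ R.interiorE) : Φ.control k s x e = 1 := by
  rw [control, if_neg he]

theorem control_of_mem (k : R.cornerV → G) (s : E → V) (x : E → G) {e : E}
    (he : e ∈ R.cornerE ∪ R.interiorE) :
    Φ.control k s x e = extendOne R.cornerV (Φ.orientation x * k⁻¹) (s e) := by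
  rw [control, if_pos he]

theorem dressMap_of_notMem (k : R.cornerV → G) (x : E → G) {e : E}
    (he : e ∉ R.cornerE ∪ R.interiorE) : Φ.dressMap k x e = x e := by
  simp [dressMap, linkTranslate, Φ.control_of_notMem k _ x he]

theorem measurePreserving_undress (k : R.cornerV → G) :
    MeasurePreserving
      (fun x : E → G => linkTranslate (Φ.control k L.tgt x) (Φ.control k L.src x) x)
      (haarPi G E) (haarPi G E) :=
  measurePreserving_controlled (R.cornerE ∪ R.interiorE) _ _ (Φ.measurable_control k L.tgt)
    (Φ.measurable_control k L.src) (fun x _ he => Φ.control_of_notMem k _ x he)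
    (fun x _ he => Φ.control_of_notMem k _ x he) (fun _ _ h => Φ.control_congr k L.tgt h)
    (fun _ _ h => Φ.control_congr k L.src h)

theorem adjoint_dress_comp_dress (k : R.cornerV → G) :
    ContinuousLinearMap.adjoint (Φ.dress k) ∘L Φ.dress k = ContinuousLinearMap.id ℂ _ :=
  adjoint_koopman_comp_self _ _

/-- The control parameter depends only on links outside the region, which the dressing leaves alone.
The same parameter can be read off again afterwards to undo it. -/
theorem dress_comp_adjoint_dress (k : R.cornerV → G) :
    Φ.dress k ∘L ContinuousLinearMap.adjoint (Φ.dress k) = ContinuousLinearMap.id ℂ _ := by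
  refine koopman_comp_adjoint (Φ.measurePreserving_undress k) _ fun x => ?_
  have h : ∀ s, Φ.control k s (Φ.dressMap k x) = Φ.control k s x := fun s =>
    Φ.control_congr k s fun e he => Φ.dressMap_of_notMem k x he
  simp only [h]
  rw [linkTranslate_linkTranslate, mul_inv_cancel, mul_inv_cancel, linkTranslate_one]

/-- Wilson lines run from the boundary to the corner, where off-corner gauge transformations are
trivial, so the control parameter is invariant. The translations themselves act at disjoint sets of
vertices. -/
theorem dress_comp_offCornerProj (k : R.cornerV → G) :
    Φ.dress k ∘L offCornerProj R = offCornerProj R ∘L Φ.dress k := by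
  refine (commute_gaugeProj L.src L.tgt (offCorner R) fun g => ?_).symm
  refine koopman_commute _ _ fun x => ?_
  have ho : Φ.orientation (linkTranslate (extendOne (offCorner R) g ∘ L.tgt)⁻¹
      (extendOne (offCorner R) g ∘ L.src)⁻¹ x) = Φ.orientation x := by
    refine Φ.orientation_linkTranslate_gauge (γ := (extendOne (offCorner R) g)⁻¹) ?_ ?_ x
    · intro v hv
      simp [extendOne, offCorner, hv]
    · intro v hv
      simp [extendOne, offCorner, Lattice.bulk, hv]
  have hc : ∀ s, Φ.control k s (linkTranslate (extendOne (offCorner R) g ∘ L.tgt)⁻¹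
      (extendOne (offCorner R) g ∘ L.src)⁻¹ x) = Φ.control k s x := by
    intro s
    funext e
    simp only [control, ho]
  simp only [hc]
  rw [linkTranslate_linkTranslate, linkTranslate_linkTranslate]
  have hcomm : ∀ s : E → V, (Φ.control k s x)⁻¹ * (extendOne (offCorner R) g ∘ s)⁻¹ =
      (extendOne (offCorner R) g ∘ s)⁻¹ * (Φ.control k s x)⁻¹ := by
    intro s
    funext e
    by_cases he : e ∈ R.cornerE ∪ R.interiorE
    · simp only [Pi.mul_apply, Pi.inv_apply, Φ.control_of_mem k s x he]
      exact (commute_extendOne _ g (s e)).inv_inv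
    · simp [Φ.control_of_notMem k s x he]
  rw [hcomm, hcomm]

/-- Gauge invariant observables of the region commute with the dressing. -/
theorem dress_comp_of_invariant {F : Finset E} (hF : SeparatedBy L F (offCorner R))
    (hFR : F ⊆ R.cornerE ∪ R.interiorE) {f : LinkSpace G F →L[ℂ] LinkSpace G F}
    {X : LinkSpace G E →L[ℂ] LinkSpace G E} (hX : ActsAs R f X)
    (hinv : ∀ g : R.cornerV → G,
      gaugeAt L.src L.tgt R.cornerV g ∘L X = X ∘L gaugeAt L.src L.tgt R.cornerV g)
    (k : R.cornerV → G) : Φ.dress k ∘L X = X ∘L Φ.dress k := by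
  -- The links in `F` are filled with the arbitrary value `1`: they lie in the region, so the
  -- orientation does not see them.
  let glue : ((Fᶜ : Finset E) → G) → E → G := fun y => (splitLinks F).symm (1, y)
  have hglue : ∀ (x : E → G), ∀ e ∉ F, x e = glue (splitLinks F x).2 e := by
    intro x e he
    simp [glue, splitLinks, MeasurableEquiv.symm, he]
  have hglue' : ∀ (x : E → G), ∀ e ∉ R.cornerE ∪ R.interiorE, x e = glue (splitLinks F x).2 e :=
    fun x e he => hglue x e fun h => he (hFR h)
  -- At fixed `y`, the dressing acts on `F` as the ordinary corner gauge transformation by `c y`,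
  -- with which `f` commutes.
  let c : ((Fᶜ : Finset E) → G) → R.cornerV → G := fun y => Φ.orientation (glue y) * k⁻¹
  refine hX.commute_koopman hF (Φ.measurePreserving_dress k)
    (fun y => linkTranslate (extendOne R.cornerV (c y) ∘ fun e : F => L.tgt e)⁻¹
      (extendOne R.cornerV (c y) ∘ fun e : F => L.src e)⁻¹)
    (fun y => measurePreserving_linkTranslate _ _)
    (fun y => (splitLinks F (Φ.dressMap k (glue y))).2) ?_ ?_
    (fun y => hX.commute_gaugeAt (hinv (c y))) (Φ.dress_comp_offCornerProj k)
  · intro x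
    funext e
    change Φ.dressMap k x e = _
    simp only [dressMap, linkTranslate, Pi.inv_apply, Φ.control_of_mem k _ x (hFR e.2), c,
      Function.comp, ← Φ.orientation_congr (hglue' x)]
    rfl
  · intro x
    funext e
    change Φ.dressMap k x e = Φ.dressMap k _ e
    simp only [dressMap, ← Φ.control_congr k _ (hglue' x)]
    simp only [linkTranslate, ← hglue x e (Finset.mem_compl.1 e.2)]

theorem reorientation_eq_koopman (h : R.cornerV → G) :
    Φ.reorientation h = koopman (Φ.reorientMap h) (measurePreserving_linkTranslate _ _) := rfl

theorem reorientation_comp_adjoint (h : R.cornerV → G) :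
    Φ.reorientation h ∘L ContinuousLinearMap.adjoint (Φ.reorientation h) =
      ContinuousLinearMap.id ℂ _ := by
  rw [reorientation, adjoint_linkUnitary, linkUnitary_comp, mul_inv_cancel, mul_inv_cancel,
    linkUnitary_one]

/-- Frame reorientations commute with gauge projections at bulk vertices. -/
theorem reorientation_comp_gaugeProj (h : R.cornerV → G) {S : Finset V}
    (hS : ∀ v ∈ S, v ∉ L.boundary) :
    Φ.reorientation h ∘L gaugeProj L.src L.tgt S = gaugeProj L.src L.tgt S ∘L Φ.reorientation h := by
  refine (commute_gaugeProj L.src L.tgt S fun g => ?_).symm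
  rw [reorientation, gaugeAt, gaugeUnitary, linkUnitary_comp, linkUnitary_comp]
  -- The reorientation acts on `e` only at an endpoint on the boundary, where the gauge
  -- transformation is `1`.
  have key : ∀ (o : Bool) (s : E → V), (∀ e, L.start (e, o) = s e) →
      (extendOne S g ∘ s) * Φ.onFirstEdges o h = Φ.onFirstEdges o h * (extendOne S g ∘ s) := by
    intro o s hs
    funext e
    by_cases he : L.start (e, o) ∈ L.boundary
    · have : s e ∉ S := fun hS' => hS _ hS' (hs e ▸ he)
      simp [extendOne, this]
    · simp [Φ.onFirstEdges_eq_one_of_notMem_boundary o h he]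
  rw [key false L.tgt fun _ => rfl, key true L.src fun _ => rfl]

theorem reorientation_comp_offCornerProj (h : R.cornerV → G) :
    Φ.reorientation h ∘L offCornerProj R = offCornerProj R ∘L Φ.reorientation h :=
  Φ.reorientation_comp_gaugeProj h fun _ hv => notMem_boundary_of_mem_offCorner hv

theorem reorientation_comp_cornerProj (h : R.cornerV → G) :
    Φ.reorientation h ∘L cornerProj R = cornerProj R ∘L Φ.reorientation h :=
  Φ.reorientation_comp_gaugeProj h fun _ hv => notMem_boundary_of_mem_cornerV hv

/-- Observables of the region commute with frame reorientations. -/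
theorem reorientation_comp_of_actsAs {F : Finset E} (hF : SeparatedBy L F (offCorner R))
    (hFR : F ⊆ R.cornerE ∪ R.interiorE) {f : LinkSpace G F →L[ℂ] LinkSpace G F}
    {X : LinkSpace G E →L[ℂ] LinkSpace G E} (hX : ActsAs R f X) (h : R.cornerV → G) :
    Φ.reorientation h ∘L X = X ∘L Φ.reorientation h := by
  refine hX.commute_koopman_of_fixed hF (T := Φ.reorientMap h) (measurePreserving_linkTranslate _ _)
    (linkTranslate (fun e => (Φ.onFirstEdges false h)⁻¹ e) (fun e => (Φ.onFirstEdges true h)⁻¹ e))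
    ?_ (fun _ => rfl) (Φ.reorientation_comp_offCornerProj h)
  intro x e he
  simp [reorientMap, linkTranslate, Φ.onFirstEdges_eq_one_of_mem_region _ h (hFR he)]

/-- A reorientation of `Φ` moves past the dressing by a frame `Ψ`, at the cost of the change of
orientation of `Ψ`. -/
theorem reorientation_comp_dress (Ψ : ExtrinsicFrame R) (h k k' : R.cornerV → G)
    (ho : ∀ x : E → G, Ψ.orientation (Φ.reorientMap h x) * k⁻¹ = Ψ.orientation x * k'⁻¹) :
    Φ.reorientation h ∘L Ψ.dress k = Ψ.dress k' ∘L Φ.reorientation h := by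
  rw [reorientation_eq_koopman, dress_eq_koopman, dress_eq_koopman, koopman_comp, koopman_comp]
  refine koopman_congr _ _ (funext fun x => ?_)
  have hc : ∀ s, Ψ.control k s (Φ.reorientMap h x) = Ψ.control k' s x := by
    intro s
    funext e
    simp only [control, ho]
  simp only [Function.comp]
  rw [dressMap, hc, hc]
  funext e
  by_cases he : e ∈ R.cornerE ∪ R.interiorE
  · simp [linkTranslate, Φ.onFirstEdges_eq_one_of_mem_region _ h he]
  · simp [linkTranslate, Ψ.control_of_notMem k' _ x he]

end ExtrinsicFrame

variable (R) in
/-- The action of the corner gauge group on the links outside the region. -/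
def exteriorGauge (g : R.cornerV → G) : LinkSpace G E →L[ℂ] LinkSpace G E :=
  linkUnitary (fun e => if e ∈ R.cornerE ∪ R.interiorE then 1 else extendOne R.cornerV g (L.tgt e))
    (fun e => if e ∈ R.cornerE ∪ R.interiorE then 1 else extendOne R.cornerV g (L.src e))

theorem exteriorGauge_comp_adjoint (g : R.cornerV → G) :
    exteriorGauge R g ∘L ContinuousLinearMap.adjoint (exteriorGauge R g) =
      ContinuousLinearMap.id ℂ _ := by
  rw [exteriorGauge, adjoint_linkUnitary, linkUnitary_comp, mul_inv_cancel, mul_inv_cancel,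
    linkUnitary_one]

theorem exteriorGauge_comp_offCornerProj (g : R.cornerV → G) :
    exteriorGauge R g ∘L offCornerProj R = offCornerProj R ∘L exteriorGauge R g := by
  refine (commute_gaugeProj L.src L.tgt (offCorner R) fun g' => ?_).symm
  rw [exteriorGauge, gaugeAt, gaugeUnitary, linkUnitary_comp, linkUnitary_comp]
  have key : ∀ s : E → V, ((extendOne (offCorner R) g' ∘ s) * fun e =>
      if e ∈ R.cornerE ∪ R.interiorE then 1 else extendOne R.cornerV g (s e)) =
      (fun e => if e ∈ R.cornerE ∪ R.interiorE then 1 else extendOne R.cornerV g (s e)) *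
        (extendOne (offCorner R) g' ∘ s) := by
    intro s
    funext e
    by_cases he : e ∈ R.cornerE ∪ R.interiorE
    · simp only [Pi.mul_apply, he, if_true, mul_one, one_mul]
    · simp only [Pi.mul_apply, he, if_false]
      exact (commute_extendOne g g' (s e)).symm
  rw [key, key]

theorem exteriorGauge_comp_of_actsAs {F : Finset E} (hF : SeparatedBy L F (offCorner R))
    (hFR : F ⊆ R.cornerE ∪ R.interiorE) {f : LinkSpace G F →L[ℂ] LinkSpace G F}
    {X : LinkSpace G E →L[ℂ] LinkSpace G E} (hX : ActsAs R f X) (g : R.cornerV → G) :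
    exteriorGauge R g ∘L X = X ∘L exteriorGauge R g := by
  refine hX.commute_koopman_of_fixed hF (measurePreserving_linkTranslate _ _)
    (linkTranslate (fun e => _) (fun e => _)) ?_ (fun _ => rfl) (exteriorGauge_comp_offCornerProj g)
  intro x e he
  simp only [linkTranslate, Pi.inv_apply, hFR he, if_true]
  simp

/-! ### Reorientations acting on relational observables -/

namespace ExtrinsicFrame

/-- For orientation `a`, one has `a (k h⁻¹)⁻¹ = (a k⁻¹)(k h k⁻¹)`. The extra factor does not depend
on the configuration, so it is a corner gauge transformation restricted to the region, that is, a
full one with its exterior part undone. -/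
theorem dress_mul_inv (h k : R.cornerV → G) :
    Φ.dress (k * h⁻¹) = Φ.dress k ∘L gaugeAt L.src L.tgt R.cornerV (k * h * k⁻¹) ∘L
      exteriorGauge R (k * h * k⁻¹)⁻¹ := by
  rw [exteriorGauge, gaugeAt, gaugeUnitary, linkUnitary_comp, linkUnitary_eq_koopman,
    dress_eq_koopman, dress_eq_koopman, koopman_comp]
  refine koopman_congr _ _ (funext fun x => ?_)
  rw [Function.comp, dressMap, dressMap, linkTranslate_linkTranslate]
  have key : ∀ s : E → V, Φ.control (k * h⁻¹) s x = Φ.control k s x *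
      ((extendOne R.cornerV (k * h * k⁻¹) ∘ s) * fun e => if e ∈ R.cornerE ∪ R.interiorE then 1
        else extendOne R.cornerV (k * h * k⁻¹)⁻¹ (s e)) := by
    intro s
    funext e
    by_cases he : e ∈ R.cornerE ∪ R.interiorE
    · simp only [Pi.mul_apply, he, if_true, mul_one, Φ.control_of_mem _ s x he, Function.comp]
      rw [← Pi.mul_apply (extendOne _ _), ← extendOne_mul]
      congr 1
      group
    · simp only [Pi.mul_apply, he, if_false, Φ.control_of_notMem _ s x he, Function.comp,
        extendOne_inv, Pi.inv_apply, mul_inv_cancel, mul_one]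
  rw [key, key, mul_inv_rev _ (_ * _), mul_inv_rev _ (_ * _)]

/-- Reorienting the frame acts on relational observables as a gauge transformation of the
observable of the region. -/
theorem reorientation_conj_relationalObservable {F : Finset E} (hF : SeparatedBy L F (offCorner R))
    (hFR : F ⊆ R.cornerE ∪ R.interiorE) {f : LinkSpace G F →L[ℂ] LinkSpace G F}
    {X : LinkSpace G E →L[ℂ] LinkSpace G E} (hX : ActsAs R f X) (h k : R.cornerV → G) :
    Φ.reorientation h ∘L (Φ.relationalObservable k X ∘L cornerProj R) ∘L
        ContinuousLinearMap.adjoint (Φ.reorientation h) =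
      Φ.dress k ∘L (gaugeAt L.src L.tgt R.cornerV (k * h * k⁻¹) ∘L X ∘L
        gaugeAt L.src L.tgt R.cornerV (k * h * k⁻¹)⁻¹) ∘L
        ContinuousLinearMap.adjoint (Φ.dress k) ∘L cornerProj R := by
  have hVD : Φ.reorientation h ∘L Φ.dress k = Φ.dress k ∘L
      gaugeAt L.src L.tgt R.cornerV (k * h * k⁻¹) ∘L
      exteriorGauge R (k * h * k⁻¹)⁻¹ ∘L Φ.reorientation h := by
    rw [Φ.reorientation_comp_dress Φ h k (k * h⁻¹), dress_mul_inv]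
    · simp only [ContinuousLinearMap.comp_assoc]
    · intro x
      rw [orientation_reorientMap]
      group
  have hPV : cornerProj R ∘L ContinuousLinearMap.adjoint (Φ.reorientation h) =
      ContinuousLinearMap.adjoint (Φ.reorientation h) ∘L cornerProj R := by
    exact (comp_adjoint_of_commute (Φ.reorientation_comp_cornerProj h).symm
      (Φ.reorientation_comp_adjoint h) (adjoint_koopman_comp_self _ _))
  rw [← adjoint_gaugeAt]
  exact conj_conj_of_commute hVD hPV (Φ.reorientation_comp_of_actsAs hF hFR hX h)
    (exteriorGauge_comp_of_actsAs hF hFR hX _) (Φ.reorientation_comp_adjoint h)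
    (exteriorGauge_comp_adjoint _)

theorem relationalObservable_of_invariant {F : Finset E} (hF : SeparatedBy L F (offCorner R))
    (hFR : F ⊆ R.cornerE ∪ R.interiorE) {f : LinkSpace G F →L[ℂ] LinkSpace G F}
    {X : LinkSpace G E →L[ℂ] LinkSpace G E} (hX : ActsAs R f X)
    (hinv : ∀ g : R.cornerV → G,
      gaugeAt L.src L.tgt R.cornerV g ∘L X = X ∘L gaugeAt L.src L.tgt R.cornerV g)
    (k : R.cornerV → G) : Φ.relationalObservable k X = X := by
  rw [relationalObservable, ← ContinuousLinearMap.comp_assoc,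
    Φ.dress_comp_of_invariant hF hFR hX hinv, ContinuousLinearMap.comp_assoc,
    dress_comp_adjoint_dress, ContinuousLinearMap.comp_id]

theorem norm_reorientation_conj_le (h : R.cornerV → G) (Z : LinkSpace G E →L[ℂ] LinkSpace G E) :
    ‖Φ.reorientation h ∘L Z ∘L ContinuousLinearMap.adjoint (Φ.reorientation h)‖ ≤ ‖Z‖ := by
  rw [reorientation, adjoint_linkUnitary]
  refine (ContinuousLinearMap.opNorm_comp_le _ _).trans ((mul_le_mul (norm_linkUnitary_le _ _)
    ((ContinuousLinearMap.opNorm_comp_le _ _).trans (mul_le_mul_of_nonneg_left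
      (norm_linkUnitary_le _ _) (norm_nonneg _))) (norm_nonneg _) zero_le_one).trans ?_)
  simp

/-- Averaging a relational observable over the reorientations of the frame gives the average of the
observable of the region over the corner gauge group. -/
theorem reorientationTwirl_relationalObservable {F : Finset E}
    (hF : SeparatedBy L F (offCorner R)) (hFR : F ⊆ R.cornerE ∪ R.interiorE)
    {f : LinkSpace G F →L[ℂ] LinkSpace G F} {X : LinkSpace G E →L[ℂ] LinkSpace G E}
    (hX : ActsAs R f X) (k : R.cornerV → G) :
    Φ.reorientationTwirl (Φ.relationalObservable k X ∘L cornerProj R) =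
      gaugeTwirl L.src L.tgt R.cornerV X ∘L cornerProj R := by
  -- The averaged observable is gauge invariant, so it may be dressed at no cost; both sides then
  -- have the same outer dressing.
  rw [← Φ.relationalObservable_of_invariant hF hFR hX.gaugeTwirl
    (fun g => gaugeAt_comp_gaugeTwirl _ _ _ X g) k]
  ext1 φ
  have hA : ∀ (h : R.cornerV → G) (φ : LinkSpace G E),
      (Φ.reorientation h ∘L (Φ.relationalObservable k X ∘L cornerProj R) ∘L
        ContinuousLinearMap.adjoint (Φ.reorientation h)) φ =
      Φ.dress k (gaugeAt L.src L.tgt R.cornerV (linkTranslate k k h) (X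
        (gaugeAt L.src L.tgt R.cornerV (linkTranslate k k h)⁻¹
          (ContinuousLinearMap.adjoint (Φ.dress k) (cornerProj R φ))))) := by
    intro h φ
    rw [reorientation_conj_relationalObservable Φ hF hFR hX]
    rfl
  have hk : Continuous fun h : R.cornerV → G => linkTranslate k k h := by
    unfold linkTranslate
    fun_prop
  rw [reorientationTwirl, twirl, strongAverage_apply (C := ‖Φ.relationalObservable k X ∘L cornerProj R‖)
    _ (fun h => Φ.norm_reorientation_conj_le h _)]
  · simp only [hA]
    simp only [relationalObservable, ContinuousLinearMap.comp_apply]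
    set ξ := ContinuousLinearMap.adjoint (Φ.dress k) (cornerProj R φ)
    have hint := integrable_conj_gaugeAt L.src L.tgt R.cornerV X ξ
    -- `linkTranslate k k` is the conjugation `h ↦ k h k⁻¹`, which preserves Haar measure; the
    -- change of variables removes `k`.
    have hmp := measurePreserving_linkTranslate k k
    rw [gaugeTwirl_apply, ContinuousLinearMap.integral_comp_comm]
    · congr 1
      exact (integral_map hmp.measurable.aemeasurable
        (by rw [hmp.map_eq]; exact hint.aestronglyMeasurable)).symm.trans (by rw [hmp.map_eq])
    · exact hmp.integrable_comp_of_integrable hint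
  · intro φ
    simp only [hA]
    exact (Φ.dress k).continuous.comp
      ((continuous_conj_gaugeAt L.src L.tgt R.cornerV X _).comp hk)

theorem reorientationTwirl_of_commute {Z : LinkSpace G E →L[ℂ] LinkSpace G E}
    (hZ : ∀ h : R.cornerV → G, Φ.reorientation h ∘L Z = Z ∘L Φ.reorientation h) :
    Φ.reorientationTwirl Z = Z := by
  have hA : ∀ h : R.cornerV → G, Φ.reorientation h ∘L Z ∘L
      ContinuousLinearMap.adjoint (Φ.reorientation h) = Z := by
    intro h
    rw [← ContinuousLinearMap.comp_assoc, hZ, ContinuousLinearMap.comp_assoc,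
      reorientation_comp_adjoint, ContinuousLinearMap.comp_id]
  ext1 φ
  rw [reorientationTwirl, twirl, strongAverage_apply (C := ‖Z‖) _
    (fun h => Φ.norm_reorientation_conj_le h _)]
  · simp only [hA, integral_const, probReal_univ]
    exact one_smul ℝ _
  · intro φ
    simp only [hA]
    exact continuous_const

/-- Observables relative to `Φ'` are invariant under reorientations of a non-overlapping frame. -/
theorem reorientation_comp_relationalObservable {Φ Φ' : ExtrinsicFrame R}
    (hΦ : NonOverlapping Φ Φ') {F : Finset E} (hF : SeparatedBy L F (offCorner R))
    (hFR : F ⊆ R.cornerE ∪ R.interiorE) {f : LinkSpace G F →L[ℂ] LinkSpace G F}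
    {X : LinkSpace G E →L[ℂ] LinkSpace G E} (hX : ActsAs R f X) (h k : R.cornerV → G) :
    Φ.reorientation h ∘L (Φ'.relationalObservable k X ∘L cornerProj R) =
      (Φ'.relationalObservable k X ∘L cornerProj R) ∘L Φ.reorientation h := by
  have h1 := Φ.reorientation_comp_dress Φ' h k k
    fun x => by rw [orientation_reorientMap_of_nonOverlapping hΦ]
  exact commute_conj_comp h1 (comp_adjoint_of_commute h1 (Φ'.dress_comp_adjoint_dress k)
    (Φ'.adjoint_dress_comp_dress k)) (Φ.reorientation_comp_of_actsAs hF hFR hX h)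
    (Φ.reorientation_comp_cornerProj h)

end ExtrinsicFrame

/-! ### The intersection of relational algebras -/

variable {F : Finset E}

theorem gaugeTwirl_mem_invariantSubsystemAlgebra (hF : SeparatedBy L F (offCorner R))
    {f : LinkSpace G F →L[ℂ] LinkSpace G F} {X : LinkSpace G E →L[ℂ] LinkSpace G E}
    (hX : ActsAs R f X) : gaugeTwirl L.src L.tgt R.cornerV X ∈ invariantSubsystemAlgebra R F :=
  ⟨(mem_subsystemAlgebra_iff hF).2 ⟨_, hX.gaugeTwirl⟩,
    fun g => gaugeAt_comp_gaugeTwirl _ _ _ X g⟩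

theorem image_cornerProj_subsystemAlgebra (hF : SeparatedBy L F (offCorner R)) :
    (fun X : LinkSpace G E →L[ℂ] LinkSpace G E => cornerProj R ∘L X ∘L cornerProj R) ''
        subsystemAlgebra R F =
      (fun X : LinkSpace G E →L[ℂ] LinkSpace G E => X ∘L cornerProj R) ''
        invariantSubsystemAlgebra R F := by
  ext Z
  constructor
  · rintro ⟨X, hX, rfl⟩
    obtain ⟨f, hf⟩ := (mem_subsystemAlgebra_iff hF).1 hX
    exact ⟨_, gaugeTwirl_mem_invariantSubsystemAlgebra hF hf,
      (gaugeProj_comp_comp_gaugeProj L.src L.tgt R.cornerV X).symm⟩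
  · rintro ⟨X, hX, rfl⟩
    refine ⟨X, hX.1, ?_⟩
    exact (gaugeProj_comp_comp_gaugeProj L.src L.tgt R.cornerV X).trans
      (by rw [gaugeTwirl_of_commute _ _ _ X hX.2]; rfl)

theorem image_invariantSubsystemAlgebra_subset (hF : SeparatedBy L F (offCorner R))
    (hFR : F ⊆ R.cornerE ∪ R.interiorE) (k : R.cornerV → G) :
    (fun X : LinkSpace G E →L[ℂ] LinkSpace G E => X ∘L cornerProj R) ''
        invariantSubsystemAlgebra R F ⊆ Φ.relationalAlgebra k F := by
  rintro _ ⟨X, hX, rfl⟩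
  obtain ⟨f, hf⟩ := (mem_subsystemAlgebra_iff hF).1 hX.1
  refine ⟨X, hX.1, ?_⟩
  simp only [Φ.relationalObservable_of_invariant hF hFR hf hX.2]

/-- The twirl of the observable of `X` is the gauge average of `X` times the projector. Gauge
averages are invariant, and an invariant `X` is its own average. -/
theorem image_invariantSubsystemAlgebra_eq_reorientationTwirl
    (hF : SeparatedBy L F (offCorner R)) (hFR : F ⊆ R.cornerE ∪ R.interiorE)
    (k : R.cornerV → G) :
    (fun X : LinkSpace G E →L[ℂ] LinkSpace G E => X ∘L cornerProj R) ''
        invariantSubsystemAlgebra R F = Φ.reorientationTwirl '' Φ.relationalAlgebra k F := by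
  ext Z
  constructor
  · rintro ⟨X, hX, rfl⟩
    obtain ⟨f, hf⟩ := (mem_subsystemAlgebra_iff hF).1 hX.1
    refine ⟨_, ⟨X, hX.1, rfl⟩, ?_⟩
    simp only [Φ.reorientationTwirl_relationalObservable hF hFR hf,
      gaugeTwirl_of_commute _ _ _ X hX.2]
  · rintro ⟨_, ⟨X, hX, rfl⟩, rfl⟩
    obtain ⟨f, hf⟩ := (mem_subsystemAlgebra_iff hF).1 hX
    exact ⟨_, gaugeTwirl_mem_invariantSubsystemAlgebra hF hf,
      (Φ.reorientationTwirl_relationalObservable hF hFR hf k).symm⟩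

/-- Membership relative to `Φ'` makes an element equal to its own twirl over `Φ`; membership
relative to `Φ` places that twirl in the invariant algebra times the projector. -/
theorem relationalAlgebra_inter {Φ Φ' : ExtrinsicFrame R} (hΦ : NonOverlapping Φ Φ')
    (hF : SeparatedBy L F (offCorner R)) (hFR : F ⊆ R.cornerE ∪ R.interiorE)
    (k k' : R.cornerV → G) :
    Φ.relationalAlgebra k F ∩ Φ'.relationalAlgebra k' F =
      (fun X : LinkSpace G E →L[ℂ] LinkSpace G E => X ∘L cornerProj R) ''
        invariantSubsystemAlgebra R F := by
  refine Set.Subset.antisymm ?_ (Set.subset_inter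
    (image_invariantSubsystemAlgebra_subset Φ hF hFR k)
    (image_invariantSubsystemAlgebra_subset Φ' hF hFR k'))
  rintro Z ⟨hZ, X, hX, rfl⟩
  obtain ⟨f, hf⟩ := (mem_subsystemAlgebra_iff hF).1 hX
  rw [image_invariantSubsystemAlgebra_eq_reorientationTwirl Φ hF hFR k]
  exact ⟨_, hZ, Φ.reorientationTwirl_of_commute fun h =>
    ExtrinsicFrame.reorientation_comp_relationalObservable hΦ hF hFR hf h k'⟩

end Frames

end LatticeGauge

end

theorem proposition1
    {G : Type*} [Group G] [TopologicalSpace G] [IsTopologicalGroup G] [CompactSpace G]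
    [T2Space G] [SecondCountableTopology G] [MeasurableSpace G] [BorelSpace G]
    {V E : Type*} [Fintype V] [DecidableEq V] [Fintype E] [DecidableEq E]
    {L : Lattice V E} {R : Region L} (T : IntrinsicFrame R)
    (Φ Φ' : ExtrinsicFrame R) (hΦ : NonOverlapping Φ Φ')
    (α : Finset RegionalPart) (hα : α.Nonempty)
    (k k' : R.cornerV → G) :
    Φ.relationalAlgebra k (subsystemEdges T α) ∩ Φ'.relationalAlgebra k' (subsystemEdges T α) =
        (fun X => cornerProj R ∘L X ∘L cornerProj R) '' subsystemAlgebra R (subsystemEdges T α) ∧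
    (fun X => cornerProj R ∘L X ∘L cornerProj R) '' subsystemAlgebra R (subsystemEdges T α) =
        (fun X : LinkSpace G E →L[ℂ] LinkSpace G E => X ∘L cornerProj R) ''
          invariantSubsystemAlgebra R (subsystemEdges T α) ∧
    (fun X : LinkSpace G E →L[ℂ] LinkSpace G E => X ∘L cornerProj R) ''
          invariantSubsystemAlgebra R (subsystemEdges T α) =
        Φ.reorientationTwirl '' Φ.relationalAlgebra k (subsystemEdges T α) ∧
    Φ.reorientationTwirl '' Φ.relationalAlgebra k (subsystemEdges T α) =
        Φ'.reorientationTwirl '' Φ'.relationalAlgebra k' (subsystemEdges T α) := by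
  have hF := separatedBy_subsystemEdges T α
  have hFR := subsystemEdges_subset T α
  have hI := image_cornerProj_subsystemAlgebra (G := G) hF
  have hJ := image_invariantSubsystemAlgebra_eq_reorientationTwirl Φ hF hFR k
  have hJ' := image_invariantSubsystemAlgebra_eq_reorientationTwirl Φ' hF hFR k'
  -- Every set is compared with the projected invariant algebra, which involves neither `k` nor
  -- `k'`; this is why the two orientations may be chosen independently.
  exact ⟨(relationalAlgebra_inter hΦ hF hFR k k').trans hI.symm, hI, hJ, hJ.symm.trans hJ'⟩
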